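/- Fix a critical exponent $\alpha>1$. For $c\in(0,1)$ and $u,v\in[0,1]$ let the standard Lorenz map $q:[0,1]\setminus\{c\}\to[0,1]$ be $$q(x)=\begin{cases}u\left(1-\left(\frac{c-x}{c}\right)^{\alpha}\right), & x\in[0,c),\\[2pt] 1+v\left(-1+\left(\frac{x-c}{1-c}\right)^{\alpha}\right), & x\in(c,1].\end{cases}$$ A Lorenz map with critical point $c$ is a map $f:[0,1]\setminus\{c\}\to[0,1]$ with $f=\phi_-\circ q$ on $[0,c)$ and $f=\phi_+\circ q$ on $(c,1]$, where the diffeomorphic parts $\phi_\pm$ are increasing $C^3$ diffeomorphisms of $[0,1]$ with nonpositive Schwarzian derivative, such that $f(c^+)<c<f(c^-)$ (one-sided limits) and the only fixed points of $f$ are $0$ and $1$. It is full if both of its branches, extended to $[0,c]$ and $[c,1]$ by these one-sided limits, map onto $[0,1]$, i.e. $f(c^-)=1$ and $f(c^+)=0$. It is $\epsilon$-close to standard maps if the $C^2$-distance on $[0,1]$ of each of $\phi_-$ and $\phi_+$ to the identity is at most $\epsilon$. There exists $\epsilon>0$ (depending only on $\alpha$) with the following property. For every $K>0$ there exists $w>0$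 such that every full Lorenz map $f$ with critical exponent $\alpha$ which is $\epsilon$-close to standard maps and whose critical point satisfies $c\in[\frac1K,1-\frac1K]$ has a unique invariant probability measure $\mu$ on $[0,1]$ that is absolutely continuous with respect to Lebesgue measure, and $$\mu([0,c])\ge w\quad\text{and}\quad \mu([c,1])\ge w.$$ -/

import Mathlib

open Set MeasureTheory

noncomputable section

namespace Lorenz

/-- The Schwarzian derivative `φ'''/φ' - (3/2) (φ''/φ')²` of a function on `[0,1]`
(one-sided derivatives at the end points). -/
def schwarzian (φ : ℝ → ℝ) (x : ℝ) : ℝ :=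
  iteratedDerivWithin 3 φ (Icc 0 1) x / iteratedDerivWithin 1 φ (Icc 0 1) x -
    3 / 2 * (iteratedDerivWithin 2 φ (Icc 0 1) x / iteratedDerivWithin 1 φ (Icc 0 1) x) ^ 2

/-- `φ` restricts to an increasing `C³` diffeomorphism of `[0,1]` with nonpositive Schwarzian
derivative. (The identity, whose Schwarzian derivative vanishes, is allowed; values of `φ`
outside `[0,1]` are irrelevant.) -/
structure IsDiffeoPart (φ : ℝ → ℝ) : Prop where
  contDiffOn : ContDiffOn ℝ 3 φ (Icc 0 1)
  bijOn : BijOn φ (Icc 0 1) (Icc 0 1)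
  deriv_pos : ∀ x ∈ Icc (0 : ℝ) 1, 0 < iteratedDerivWithin 1 φ (Icc 0 1) x
  schwarzian_nonpos : ∀ x ∈ Icc (0 : ℝ) 1, schwarzian φ x ≤ 0

/-- The `C²`-distance on `[0,1]` between `φ` and the identity is at most `ε`. -/
def C2CloseToId (ε : ℝ) (φ : ℝ → ℝ) : Prop :=
  ∀ x ∈ Icc (0 : ℝ) 1,
    |φ x - x| ≤ ε ∧
    |iteratedDerivWithin 1 φ (Icc 0 1) x - 1| ≤ ε ∧
    |iteratedDerivWithin 2 φ (Icc 0 1) x| ≤ ε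

/-- The left branch, on `[0,c]`, of the standard Lorenz map with critical exponent `α`. Its value
at `c` is the limit of the standard map from the left. -/
def stdLeft (α c u x : ℝ) : ℝ := u * (1 - ((c - x) / c) ^ α)

/-- The right branch, on `[c,1]`, of the standard Lorenz map with critical exponent `α`. Its value
at `c` is the limit of the standard map from the right. -/
def stdRight (α c v x : ℝ) : ℝ := 1 + v * (-1 + ((x - c) / (1 - c)) ^ α)

/-- The left branch `φ₋ ∘ q` on `[0,c]`. -/
def leftBranch (α c u : ℝ) (φ : ℝ → ℝ) (x : ℝ) : ℝ := φ (stdLeft α c u x)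

/-- The right branch `φ₊ ∘ q` on `[c,1]`. -/
def rightBranch (α c v : ℝ) (φ : ℝ → ℝ) (x : ℝ) : ℝ := φ (stdRight α c v x)

/-- The map on `[0,1] \ {c}` made of the two branches; its value at `c` and outside `[0,1]` is
irrelevant. -/
def lorenzFun (α c u v : ℝ) (φl φr : ℝ → ℝ) (x : ℝ) : ℝ :=
  if x < c then leftBranch α c u φl x else rightBranch α c v φr x

end Lorenz

/-- A Lorenz map with critical exponent `α`: it has `C³` diffeomorphic parts with nonpositive
Schwarzian derivative, is nontrivial, and has no fixed points other than `0` and `1`. -/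
structure LorenzMap (α : ℝ) where
  /-- the critical point -/
  c : ℝ
  /-- the critical values of the standard map are `u` and `1 - v` -/
  u : ℝ
  v : ℝ
  /-- the left diffeomorphic part -/
  φl : ℝ → ℝ
  /-- the right diffeomorphic part -/
  φr : ℝ → ℝ
  c_mem : c ∈ Ioo (0 : ℝ) 1
  u_mem : u ∈ Icc (0 : ℝ) 1
  v_mem : v ∈ Icc (0 : ℝ) 1
  diffeo_left : Lorenz.IsDiffeoPart φl
  diffeo_right : Lorenz.IsDiffeoPart φr
  nontrivial : Lorenz.rightBranch α c v φr c < c ∧ c < Lorenz.leftBranch α c u φl c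
  fixed_points : ∀ x ∈ Icc (0 : ℝ) 1 \ {c},
    Lorenz.lorenzFun α c u v φl φr x = x → x = 0 ∨ x = 1

namespace LorenzMap

variable {α : ℝ}

/-- The underlying map; only its values on `[0,1] \ {c}` matter. -/
def toFun (f : LorenzMap α) : ℝ → ℝ := Lorenz.lorenzFun α f.c f.u f.v f.φl f.φr

/-- Both branches map onto `[0,1]`. -/
def IsFull (f : LorenzMap α) : Prop :=
  Lorenz.leftBranch α f.c f.u f.φl '' Icc 0 f.c = Icc 0 1 ∧
  Lorenz.rightBranch α f.c f.v f.φr '' Icc f.c 1 = Icc 0 1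

/-- `f` is `ε`-close to standard maps. -/
def CloseToStandard (ε : ℝ) (f : LorenzMap α) : Prop :=
  Lorenz.C2CloseToId ε f.φl ∧ Lorenz.C2CloseToId ε f.φr

/-- `μ` is an invariant probability measure on `[0,1]` of `f`, absolutely continuous with respect
to Lebesgue measure on `[0,1]` (so that the single point `c`, where `f` is undefined, is null). -/
structure IsACIP (f : LorenzMap α) (μ : Measure ℝ) : Prop where
  prob : IsProbabilityMeasure μ
  absCont : μ ≪ volume.restrict (Icc 0 1)
  invariant : ∀ A : Set ℝ, MeasurableSet A → μ {x ∈ Icc (0 : ℝ) 1 \ {f.c} | f.toFun x ∈ A} = μ A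

end LorenzMap

end

/-!
A full Lorenz map has two branches onto `(0,1)`, each a composition of diffeomorphisms with
nonpositive Schwarzian derivative. Such a branch satisfies a Koebe principle on either side, and
the transfer operator therefore preserves the cone of densities `h` on `(0,1)` for which
`x² h(x)` increases and `(1 - x)² h(x)` decreases. On `[δ, 1 - δ]` such a density is bounded by a
multiple of its total mass, and throughout `(0,1)` it is at least a multiple of the mass of
`[δ, 1 - δ]`, so all that can go wrong with the push-forwards of Lebesgue measure is concentration
at `0` and `1`. Mass gets close to the endpoints only from a neighbourhood of `c`, where the
density is bounded, and then expansion at the fixed points `0` and `1` disperses it: the mass in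
the `t`-tails obeys a recursion whose contributions from `c` form a geometric series of order
`t ^ (1 / α)`. This is where closeness to standard maps is used, to have slope bounded below by
a number greater than `1` at `0` and `1`.

The push-forwards of Lebesgue measure are then uniformly absolutely continuous and uniformly bounded
below, and so are the limits of their averages. Such a limit is invariant, with a density bounded
below by a constant depending only on `α` and `K`. It is ergodic, since an invariant set of positive
measure takes up a definite proportion of every cylinder and cylinders shrink to density points.
Hence it is the only invariant probability measure absolutely continuous with respect to Lebesgue
measure.
-/

open Filter Topology
open scoped ENNReal NNReal

noncomputable section

namespace Lorenz

/-! ### Nonpositive Schwarzian derivative and the Koebe principle -/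

/-- `φ` has derivative `d > 0`, nonlinearity `Q = φ''/φ'` and `R = Q'` on the interior of `s`, all
of them extending continuously to `s`, and `R ≤ Q²/2`. Since the Schwarzian derivative of `φ` is
`R - Q²/2`, this says that it is nonpositive. -/
structure HasNonposSchwarzian (s : Set ℝ) (φ d Q R : ℝ → ℝ) : Prop where
  continuousOn : ContinuousOn φ s
  continuousOn_deriv : ContinuousOn d s
  continuousOn_nonlinearity : ContinuousOn Q s
  hasDerivAt : ∀ z ∈ interior s, HasDerivAt φ (d z) z
  hasDerivAt_deriv : ∀ z ∈ interior s, HasDerivAt d (d z * Q z) z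
  hasDerivAt_nonlinearity : ∀ z ∈ interior s, HasDerivAt Q (R z) z
  deriv_pos : ∀ z ∈ s, 0 < d z
  nonpos : ∀ z ∈ interior s, R z ≤ Q z ^ 2 / 2

namespace HasNonposSchwarzian

variable {s : Set ℝ} {p q : ℝ} {φ d Q R : ℝ → ℝ}

theorem mono {t : Set ℝ} (h : HasNonposSchwarzian s φ d Q R) (hts : t ⊆ s) :
    HasNonposSchwarzian t φ d Q R where
  continuousOn := h.continuousOn.mono hts
  continuousOn_deriv := h.continuousOn_deriv.mono hts
  continuousOn_nonlinearity := h.continuousOn_nonlinearity.mono hts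
  hasDerivAt z hz := h.hasDerivAt z (interior_mono hts hz)
  hasDerivAt_deriv z hz := h.hasDerivAt_deriv z (interior_mono hts hz)
  hasDerivAt_nonlinearity z hz := h.hasDerivAt_nonlinearity z (interior_mono hts hz)
  deriv_pos z hz := h.deriv_pos z (hts hz)
  nonpos z hz := h.nonpos z (interior_mono hts hz)

theorem reflect (h : HasNonposSchwarzian s φ d Q R) :
    HasNonposSchwarzian (Neg.neg ⁻¹' s) (fun z => -φ (-z)) (fun z => d (-z)) (fun z => -Q (-z))
      (fun z => R (-z)) := by
  have hmaps : MapsTo Neg.neg (Neg.neg ⁻¹' s) s := fun _ => id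
  have hcont : ContinuousOn Neg.neg (Neg.neg ⁻¹' s : Set ℝ) := continuous_neg.continuousOn
  have hint : interior (Neg.neg ⁻¹' s) = Neg.neg ⁻¹' interior s :=
    ((Homeomorph.neg ℝ).preimage_interior s).symm
  have hderiv : ∀ {g g' : ℝ → ℝ}, (∀ z ∈ interior s, HasDerivAt g (g' z) z) →
      ∀ z, -z ∈ interior s → HasDerivAt (fun z => g (-z)) (-g' (-z)) z := fun hg z hz => by
    simpa [Function.comp_def] using (hg _ hz).scomp z (hasDerivAt_neg z)
  refine ⟨(h.continuousOn.comp hcont hmaps).neg, h.continuousOn_deriv.comp hcont hmaps,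
    (h.continuousOn_nonlinearity.comp hcont hmaps).neg, ?_, ?_, ?_, fun z hz => h.deriv_pos _ hz,
    ?_⟩ <;> rw [hint] <;> intro z hz
  · exact (hderiv h.hasDerivAt z hz).fun_neg.congr_deriv (neg_neg _)
  · exact (hderiv h.hasDerivAt_deriv z hz).congr_deriv (mul_neg _ _).symm
  · exact (hderiv h.hasDerivAt_nonlinearity z hz).fun_neg.congr_deriv (neg_neg _)
  · simpa using h.nonpos _ hz

theorem strictMonoOn (h : HasNonposSchwarzian s φ d Q R) (hs : Convex ℝ s) : StrictMonoOn φ s :=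
  strictMonoOn_of_deriv_pos hs h.continuousOn fun z hz => by
    rw [(h.hasDerivAt z hz).deriv]
    exact h.deriv_pos z (interior_subset hz)

theorem hasDerivAt_koebe_div_sqrt (h : HasNonposSchwarzian s φ d Q R) (p : ℝ) {z : ℝ}
    (hz : z ∈ interior s) :
    HasDerivAt (fun z => (2 * (z - p) * d z - (φ z - φ p) * ((z - p) * Q z + 2)) / √(d z))
      ((φ z - φ p) * (z - p) * (Q z ^ 2 / 2 - R z) / √(d z)) z := by
  have hdz := h.deriv_pos z (interior_subset hz)
  have hs := Real.sqrt_pos.2 hdz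
  have hsq : √(d z) ^ 2 = d z := Real.sq_sqrt hdz.le
  have hid := (hasDerivAt_id z).sub_const p
  have hnum := ((hid.const_mul 2).mul (h.hasDerivAt_deriv z hz)).sub
    (((h.hasDerivAt z hz).sub_const (φ p)).mul
      ((hid.mul (h.hasDerivAt_nonlinearity z hz)).add_const 2))
  refine (hnum.div ((h.hasDerivAt_deriv z hz).sqrt hdz.ne') hs.ne').congr_deriv ?_
  simp only [id, Pi.mul_apply, Pi.sub_apply]
  field_simp
  rw [hsq]
  ring

theorem koebe_nonneg (h : HasNonposSchwarzian (Ico p q) φ d Q R) {z : ℝ} (hz : z ∈ Ioo p q) :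
    0 ≤ 2 * (z - p) * d z - (φ z - φ p) * ((z - p) * Q z + 2) := by
  have hp : p ∈ Ico p q := left_mem_Ico.2 (hz.1.trans hz.2)
  have hcont : ContinuousOn
      (fun z => (2 * (z - p) * d z - (φ z - φ p) * ((z - p) * Q z + 2)) / √(d z)) (Ico p q) := by
    refine ContinuousOn.div ?_ h.continuousOn_deriv.sqrt
      fun z hz => (Real.sqrt_pos.2 (h.deriv_pos z hz)).ne'
    have := h.continuousOn
    have := h.continuousOn_deriv
    have := h.continuousOn_nonlinearity
    fun_prop
  have hmono := monotoneOn_of_deriv_nonneg (convex_Ico p q) hcont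
    (fun z hz => (h.hasDerivAt_koebe_div_sqrt p hz).differentiableAt.differentiableWithinAt)
    fun z hz => by
      rw [(h.hasDerivAt_koebe_div_sqrt p hz).deriv]
      have hR := sub_nonneg.2 (h.nonpos z hz)
      rw [interior_Ico] at hz
      have hφ := (h.strictMonoOn (convex_Ico p q)) hp (Ioo_subset_Ico_self hz) hz.1
      exact div_nonneg (mul_nonneg (mul_nonneg (sub_pos.2 hφ).le (sub_pos.2 hz.1).le) hR)
        (Real.sqrt_nonneg _)
  have hle := hmono hp (Ioo_subset_Ico_self hz) hz.1.le
  simp only [sub_self, mul_zero, zero_mul, zero_div] at hle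
  exact nonneg_of_mul_nonneg_left (by simpa [div_eq_mul_inv] using hle)
    (inv_pos.2 (Real.sqrt_pos.2 (h.deriv_pos z (Ioo_subset_Ico_self hz))))

theorem monotoneOn_sq_div (h : HasNonposSchwarzian (Ico p q) φ d Q R) :
    MonotoneOn (fun z => (φ z - φ p) ^ 2 / (d z * (z - p) ^ 2)) (Ioo p q) := by
  have hderiv : ∀ z ∈ Ioo p q, HasDerivAt (fun z => (φ z - φ p) ^ 2 / (d z * (z - p) ^ 2))
      ((φ z - φ p) * (2 * (z - p) * d z - (φ z - φ p) * ((z - p) * Q z + 2)) /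
        (d z * (z - p) ^ 3)) z := fun z hz => by
    have hzi : z ∈ interior (Ico p q) := by rwa [interior_Ico]
    have hdz := h.deriv_pos z (Ioo_subset_Ico_self hz)
    have hzp := sub_pos.2 hz.1
    refine ((((h.hasDerivAt z hzi).sub_const (φ p)).pow 2).div ((h.hasDerivAt_deriv z hzi).mul
      (((hasDerivAt_id z).sub_const p).pow 2)) (mul_pos hdz (pow_pos hzp 2)).ne').congr_deriv ?_
    simp only [id, Pi.mul_apply, Pi.pow_apply]
    field_simp
    push_cast
    ring
  refine monotoneOn_of_deriv_nonneg (convex_Ioo p q)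
    (fun z hz => (hderiv z hz).continuousAt.continuousWithinAt) ?_ ?_ <;>
    rw [interior_Ioo] <;> intro z hz
  · exact (hderiv z hz).differentiableAt.differentiableWithinAt
  · rw [(hderiv z hz).deriv]
    have hp : p ∈ Ico p q := left_mem_Ico.2 (hz.1.trans hz.2)
    have hφ := (h.strictMonoOn (convex_Ico p q)) hp (Ioo_subset_Ico_self hz) hz.1
    exact div_nonneg (mul_nonneg (sub_pos.2 hφ).le (h.koebe_nonneg hz))
      (mul_pos (h.deriv_pos z (Ioo_subset_Ico_self hz)) (pow_pos (sub_pos.2 hz.1) 3)).le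

theorem antitoneOn_sq_div (h : HasNonposSchwarzian (Ioc p q) φ d Q R) :
    AntitoneOn (fun z => (φ q - φ z) ^ 2 / (d z * (q - z) ^ 2)) (Ioo p q) := by
  have hset : Neg.neg ⁻¹' Ioc p q = Ico (-q) (-p) := by simp
  have hreflect := (hset ▸ h.reflect).monotoneOn_sq_div
  intro x hx y hy hxy
  have := hreflect (a := -y) (b := -x) ⟨neg_lt_neg hy.2, neg_lt_neg hy.1⟩
    ⟨neg_lt_neg hx.2, neg_lt_neg hx.1⟩ (neg_le_neg hxy)
  simpa [neg_add_eq_sub] using this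

end HasNonposSchwarzian

theorem antitoneOn_mul_of_nonneg {f g : ℝ → ℝ} {s : Set ℝ} (hf : AntitoneOn f s)
    (hg : AntitoneOn g s) (hf0 : ∀ x ∈ s, 0 ≤ f x) (hg0 : ∀ x ∈ s, 0 ≤ g x) :
    AntitoneOn (f * g) s :=
  fun _ ha _ hb h => mul_le_mul (hf ha hb h) (hg ha hb h) (hg0 _ hb) (hf0 _ ha)

theorem bijOn_Ioo_of_strictMonoOn {p q : ℝ} {f : ℝ → ℝ} (hpq : p < q)
    (hf : ContinuousOn f (Icc p q)) (hmono : StrictMonoOn f (Icc p q)) :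
    BijOn f (Ioo p q) (Ioo (f p) (f q)) := by
  rw [← hf.image_Ioo_of_strictMonoOn hpq.le hmono]
  exact (hmono.injOn.mono Ioo_subset_Icc_self).bijOn_image

/-- An increasing diffeomorphism `f` of `(p, q)` onto `(0, 1)` for which both one-sided Koebe
principles hold; this is what is left of a nonpositive Schwarzian derivative once regularity beyond
differentiability is forgotten. -/
structure KoebeBranch (p q : ℝ) (f : ℝ → ℝ) : Prop where
  bijOn : BijOn f (Ioo p q) (Ioo 0 1)
  differentiableAt : ∀ x ∈ Ioo p q, DifferentiableAt ℝ f x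
  deriv_pos : ∀ x ∈ Ioo p q, 0 < deriv f x
  koebe_left : MonotoneOn (fun x => f x ^ 2 / (deriv f x * (x - p) ^ 2)) (Ioo p q)
  koebe_right : AntitoneOn (fun x => (1 - f x) ^ 2 / (deriv f x * (q - x) ^ 2)) (Ioo p q)

theorem HasNonposSchwarzian.koebeBranch {p q : ℝ} {φ d Q R : ℝ → ℝ} (hpq : p < q)
    (h : HasNonposSchwarzian (Icc p q) φ d Q R) (hp : φ p = 0) (hq : φ q = 1) :
    KoebeBranch p q φ := by
  have hderiv : ∀ x ∈ Ioo p q, HasDerivAt φ (d x) x := by simpa using h.hasDerivAt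
  refine ⟨?_, fun x hx => (hderiv x hx).differentiableAt, fun x hx => ?_, ?_, ?_⟩
  · simpa [hp, hq] using bijOn_Ioo_of_strictMonoOn hpq h.continuousOn
      (h.strictMonoOn (convex_Icc p q))
  · rw [(hderiv x hx).deriv]
    exact h.deriv_pos x (Ioo_subset_Icc_self hx)
  · refine (h.mono Ico_subset_Icc_self).monotoneOn_sq_div.congr fun x hx => ?_
    simp only [hp, sub_zero, (hderiv x hx).deriv]
  · refine (h.mono Ioc_subset_Icc_self).antitoneOn_sq_div.congr fun x hx => ?_
    simp only [hq, (hderiv x hx).deriv]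

namespace KoebeBranch

variable {p q : ℝ} {f : ℝ → ℝ}

theorem monotoneOn (h : KoebeBranch p q f) : MonotoneOn f (Ioo p q) := by
  refine (strictMonoOn_of_deriv_pos (convex_Ioo p q)
    (fun x hx => (h.differentiableAt x hx).continuousAt.continuousWithinAt) ?_).monotoneOn
  simpa using h.deriv_pos

theorem congr {g : ℝ → ℝ} (h : KoebeBranch p q f) (hg : EqOn g f (Ioo p q)) :
    KoebeBranch p q g := by
  have hnhds : ∀ x ∈ Ioo p q, g =ᶠ[𝓝 x] f := fun x hx =>
    hg.eventuallyEq_of_mem (isOpen_Ioo.mem_nhds hx)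
  have hderiv : ∀ x ∈ Ioo p q, deriv g x = deriv f x := fun x hx => (hnhds x hx).deriv_eq
  refine ⟨h.bijOn.congr hg.symm, fun x hx => (h.differentiableAt x hx).congr_of_eventuallyEq
    (hnhds x hx), fun x hx => hderiv x hx ▸ h.deriv_pos x hx, h.koebe_left.congr fun x hx => ?_,
    h.koebe_right.congr fun x hx => ?_⟩ <;> simp only [hg hx, hderiv x hx]

theorem comp {φ : ℝ → ℝ} (hφ : KoebeBranch 0 1 φ) (h : KoebeBranch p q f) :
    KoebeBranch p q (φ ∘ f) := by
  have hmaps := h.bijOn.mapsTo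
  have hderiv : ∀ x ∈ Ioo p q, deriv (φ ∘ f) x = deriv φ (f x) * deriv f x := fun x hx =>
    deriv_comp x (hφ.differentiableAt _ (hmaps hx)) (h.differentiableAt x hx)
  have hnonneg : ∀ {x y z : ℝ}, 0 < y → 0 ≤ x ^ 2 / (y * z ^ 2) := fun hy => by positivity
  refine ⟨hφ.bijOn.comp h.bijOn,
    fun x hx => (hφ.differentiableAt _ (hmaps hx)).comp x (h.differentiableAt x hx),
    fun x hx => hderiv x hx ▸ mul_pos (hφ.deriv_pos _ (hmaps hx)) (h.deriv_pos x hx), ?_, ?_⟩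
  · refine ((hφ.koebe_left.comp h.monotoneOn hmaps).mul h.koebe_left
      (fun x hx => hnonneg (hφ.deriv_pos _ (hmaps hx)))
      fun x hx => hnonneg (h.deriv_pos x hx)).congr fun x hx => ?_
    have := (hmaps hx).1
    simp only [Pi.mul_apply, Function.comp, sub_zero, hderiv x hx]
    field_simp
  · refine (antitoneOn_mul_of_nonneg (hφ.koebe_right.comp_MonotoneOn h.monotoneOn hmaps)
      h.koebe_right (fun x hx => hnonneg (hφ.deriv_pos _ (hmaps hx)))
      fun x hx => hnonneg (h.deriv_pos x hx)).congr fun x hx => ?_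
    have := sub_pos.2 (hmaps hx).2
    simp only [Pi.mul_apply, Function.comp, hderiv x hx]
    field_simp

theorem affine (hpq : p < q) : KoebeBranch p q fun x => (x - p) / (q - p) := by
  have hqp := sub_pos.2 hpq
  have hmem : ∀ x ∈ interior (Icc p q), HasDerivAt (fun x => (x - p) / (q - p)) (1 / (q - p)) x :=
    fun x _ => ((hasDerivAt_id x).sub_const p).div_const (q - p)
  refine HasNonposSchwarzian.koebeBranch (d := fun _ => 1 / (q - p)) (Q := 0) (R := 0) hpq
    ⟨by fun_prop, by fun_prop, continuousOn_const, hmem, fun x _ => ?_, fun x _ => ?_,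
      fun x _ => by positivity, fun x _ => ?_⟩ (by simp) (by simp [hqp.ne'])
  · simpa using hasDerivAt_const x _
  · exact hasDerivAt_const x _
  · simp

theorem reflect (h : KoebeBranch 0 1 f) : KoebeBranch 0 1 fun x => 1 - f (1 - x) := by
  have hmem : ∀ {x : ℝ}, x ∈ Ioo (0 : ℝ) 1 → 1 - x ∈ Ioo (0 : ℝ) 1 := Ioo.one_sub_mem
  have hbij : BijOn (fun x : ℝ => 1 - x) (Ioo 0 1) (Ioo 0 1) :=
    ⟨fun x => hmem, sub_right_injective.injOn, fun x hx => ⟨1 - x, hmem hx, sub_sub_cancel 1 x⟩⟩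
  have hasDeriv : ∀ x ∈ Ioo (0 : ℝ) 1,
      HasDerivAt (fun x => 1 - f (1 - x)) (deriv f (1 - x)) x := fun x hx => by
    simpa using ((h.differentiableAt _ (hmem hx)).hasDerivAt.scomp x
      ((hasDerivAt_id x).const_sub 1)).const_sub 1
  refine ⟨hbij.comp (h.bijOn.comp hbij), fun x hx => (hasDeriv x hx).differentiableAt,
    fun x hx => (hasDeriv x hx).deriv ▸ h.deriv_pos _ (hmem hx), fun x hx y hy hxy => ?_,
    fun x hx y hy hxy => ?_⟩
  · simpa [(hasDeriv x hx).deriv, (hasDeriv y hy).deriv] using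
      h.koebe_right (hmem hy) (hmem hx) (sub_le_sub_left hxy 1)
  · simpa [(hasDeriv x hx).deriv, (hasDeriv y hy).deriv] using
      h.koebe_left (hmem hy) (hmem hx) (sub_le_sub_left hxy 1)

end KoebeBranch

theorem hasNonposSchwarzian_rpow {α : ℝ} (hα : 1 ≤ α) :
    HasNonposSchwarzian (Ioi 0) (fun t => t ^ α) (fun t => α * t ^ (α - 1))
      (fun t => (α - 1) / t) (fun t => -((α - 1) / t ^ 2)) := by
  have hne : ∀ t ∈ Ioi (0 : ℝ), t ≠ 0 := fun t ht => ht.ne'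
  have hcont : ∀ β : ℝ, ContinuousOn (fun t : ℝ => t ^ β) (Ioi 0) := fun β =>
    continuousOn_id.rpow_const fun t ht => Or.inl (hne t ht)
  refine ⟨hcont α, continuousOn_const.mul (hcont _), continuousOn_const.div continuousOn_id hne,
    ?_, ?_, ?_, fun t ht => mul_pos (by linarith) (Real.rpow_pos_of_pos ht _), ?_⟩ <;>
    rw [interior_Ioi] <;> intro t ht <;> have ht0 := hne t ht
  · exact Real.hasDerivAt_rpow_const (Or.inl ht0)
  · refine ((Real.hasDerivAt_rpow_const (Or.inl ht0)).const_mul α).congr_deriv ?_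
    rw [Real.rpow_sub_one ht0 (α - 1)]
    ring
  · refine ((hasDerivAt_const t (α - 1)).div (hasDerivAt_id t) ht0).congr_deriv ?_
    simp [← neg_div]
  · have : 0 ≤ (α - 1) / t ^ 2 := div_nonneg (by linarith) (sq_nonneg t)
    have := sq_nonneg ((α - 1) / t)
    linarith

theorem KoebeBranch.rpow {α : ℝ} (hα : 1 ≤ α) : KoebeBranch 0 1 fun t => t ^ α := by
  have hα0 : 0 < α := by linarith
  have hderiv : ∀ t ∈ Ioo (0 : ℝ) 1, deriv (fun t : ℝ => t ^ α) t = α * t ^ (α - 1) := fun t ht =>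
    (Real.hasDerivAt_rpow_const (Or.inl ht.1.ne')).deriv
  have hmono : StrictMonoOn (fun t : ℝ => t ^ α) (Icc 0 1) :=
    (Real.strictMonoOn_rpow_Ici_of_exponent_pos hα0).mono Icc_subset_Ici_self
  refine ⟨?_, fun t ht => (Real.hasDerivAt_rpow_const (Or.inl ht.1.ne')).differentiableAt,
    fun t ht => ?_, ?_, ?_⟩
  · simpa [hα0.ne'] using bijOn_Ioo_of_strictMonoOn zero_lt_one
      (Real.continuous_rpow_const hα0.le).continuousOn hmono
  · rw [hderiv t ht]
    exact mul_pos hα0 (Real.rpow_pos_of_pos ht.1 _)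
  · have h : MonotoneOn (fun t : ℝ => t ^ (α - 1) / α) (Ioo 0 1) := fun x hx y _ hxy =>
      div_le_div_of_nonneg_right (Real.rpow_le_rpow hx.1.le hxy (by linarith)) hα0.le
    refine h.congr fun t ht => ?_
    have ht0 := ht.1
    have := Real.rpow_pos_of_pos ht0 (α - 1)
    have hpow : t ^ α = t ^ (α - 1) * t := by rw [← Real.rpow_add_one ht0.ne', sub_add_cancel]
    simp only [hderiv t ht, hpow, sub_zero]
    field_simp
  · refine ((hasNonposSchwarzian_rpow hα).mono Ioc_subset_Ioi_self).antitoneOn_sq_div.congr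
      fun t ht => ?_
    simp only [hderiv t ht, Real.one_rpow]

/-! ### Koebe measures -/

/-- Lebesgue measure on the unit interval. -/
abbrev unitLebesgue : Measure ℝ := volume.restrict (Ioo 0 1)

instance : IsProbabilityMeasure unitLebesgue := ⟨by simp⟩

theorem monotoneOn_sub_div_sq {p : ℝ} (hp : 0 ≤ p) :
    MonotoneOn (fun x => ((x - p) / x) ^ 2) (Ioi p) := fun x hx y hy hxy => by
  have hx0 : 0 < x := hp.trans_lt hx
  refine pow_le_pow_left₀ (div_nonneg (sub_pos.2 hx).le hx0.le) ?_ 2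
  rw [div_le_div_iff₀ hx0 (hp.trans_lt hy)]
  nlinarith

theorem antitoneOn_sub_div_one_sub_sq {q : ℝ} (hq : q ≤ 1) :
    AntitoneOn (fun x => ((q - x) / (1 - x)) ^ 2) (Iio q) := fun x hx y hy hxy => by
  have hmaps : ∀ {z : ℝ}, z < q → 1 - q < 1 - z := fun hz => sub_lt_sub_left hz 1
  simpa using monotoneOn_sub_div_sq (sub_nonneg.2 hq) (hmaps hy) (hmaps hx) (sub_le_sub_left hxy 1)

/-- Densities on `(0,1)` satisfying both one-sided Koebe inequalities. These form a convex cone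
which is preserved by the transfer operator of a Koebe branch. -/
structure KoebeDensity (h : ℝ → ℝ) : Prop where
  nonneg : ∀ x ∈ Ioo (0 : ℝ) 1, 0 ≤ h x
  monotoneOn : MonotoneOn (fun x => x ^ 2 * h x) (Ioo 0 1)
  antitoneOn : AntitoneOn (fun x => (1 - x) ^ 2 * h x) (Ioo 0 1)

namespace KoebeDensity

variable {h k : ℝ → ℝ}

theorem const {a : ℝ} (ha : 0 ≤ a) : KoebeDensity fun _ => a where
  nonneg _ _ := ha
  monotoneOn _ hx _ _ hxy := mul_le_mul_of_nonneg_right (pow_le_pow_left₀ hx.1.le hxy 2) ha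
  antitoneOn _ _ _ hy hxy := mul_le_mul_of_nonneg_right
    (pow_le_pow_left₀ (sub_pos.2 hy.2).le (sub_le_sub_left hxy 1) 2) ha

theorem add (hh : KoebeDensity h) (hk : KoebeDensity k) : KoebeDensity (h + k) where
  nonneg x hx := add_nonneg (hh.nonneg x hx) (hk.nonneg x hx)
  monotoneOn := (hh.monotoneOn.add hk.monotoneOn).congr fun _ _ => (mul_add _ _ _).symm
  antitoneOn := (hh.antitoneOn.add hk.antitoneOn).congr fun _ _ => (mul_add _ _ _).symm

theorem aemeasurable (hh : KoebeDensity h) : AEMeasurable h unitLebesgue := by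
  have hmono : AEMeasurable (fun x => x ^ 2 * h x) unitLebesgue :=
    aemeasurable_restrict_of_monotoneOn measurableSet_Ioo hh.monotoneOn
  refine ((measurable_inv.pow_const 2).aemeasurable.mul hmono).congr
    ((ae_restrict_mem measurableSet_Ioo).mono fun x hx => ?_)
  have := hx.1.ne'
  simp only [Pi.mul_apply]
  field_simp

theorem harnack (hh : KoebeDensity h) {δ x y : ℝ} (hδ : 0 < δ) (hx : x ∈ Icc δ (1 - δ))
    (hy : y ∈ Ioo (0 : ℝ) 1) : δ ^ 2 * h x ≤ h y := by
  have hx' : x ∈ Ioo (0 : ℝ) 1 := ⟨hδ.trans_le hx.1, by linarith [hx.2]⟩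
  have hx0 := hh.nonneg x hx'
  have hy0 := hh.nonneg y hy
  rcases le_total x y with hxy | hxy
  · calc δ ^ 2 * h x ≤ x ^ 2 * h x :=
          mul_le_mul_of_nonneg_right (pow_le_pow_left₀ hδ.le hx.1 2) hx0
      _ ≤ y ^ 2 * h y := hh.monotoneOn hx' hy hxy
      _ ≤ h y := mul_le_of_le_one_left hy0 (pow_le_one₀ hy.1.le hy.2.le)
  · calc δ ^ 2 * h x ≤ (1 - x) ^ 2 * h x :=
          mul_le_mul_of_nonneg_right (pow_le_pow_left₀ hδ.le (by linarith [hx.2]) 2) hx0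
      _ ≤ (1 - y) ^ 2 * h y := hh.antitoneOn hy hx' hxy
      _ ≤ h y := mul_le_of_le_one_left hy0
          (pow_le_one₀ (sub_pos.2 hy.2).le (sub_le_self 1 hy.1.le))

/-- With `y = f x`, the new weighted density `y² h(x) / f'(x)` is the product of the increasing
functions `x² h(x)`, `f(x)² / (f'(x) (x - p)²)` and `((x - p) / x)²`. -/
theorem transfer (hh : KoebeDensity h) {p q : ℝ} {f g : ℝ → ℝ} (hf : KoebeBranch p q f)
    (hp : 0 ≤ p) (hq : q ≤ 1) (hg : MapsTo g (Ioo 0 1) (Ioo p q))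
    (hfg : RightInvOn g f (Ioo 0 1)) : KoebeDensity fun y => h (g y) / deriv f (g y) := by
  have hsub : Ioo p q ⊆ Ioo 0 1 := Ioo_subset_Ioo hp hq
  have hgmono : MonotoneOn g (Ioo 0 1) :=
    Function.monotoneOn_of_rightInvOn_of_mapsTo hf.monotoneOn hfg hg
  have hsq : ∀ {x a : ℝ}, x ∈ Ioo p q → 0 ≤ a ^ 2 * h x := fun hx =>
    mul_nonneg (sq_nonneg _) (hh.nonneg _ (hsub hx))
  have hkoebe : ∀ {x a b : ℝ}, x ∈ Ioo p q → 0 ≤ a ^ 2 / (deriv f x * b ^ 2) := fun hx =>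
    div_nonneg (sq_nonneg _) (mul_nonneg (hf.deriv_pos _ hx).le (sq_nonneg _))
  refine ⟨fun y hy => div_nonneg (hh.nonneg _ (hsub (hg hy))) (hf.deriv_pos _ (hg hy)).le, ?_, ?_⟩
  · have hprod := ((hh.monotoneOn.mono hsub).mul hf.koebe_left (fun _ => hsq) (fun _ => hkoebe)).mul
      ((monotoneOn_sub_div_sq hp).mono fun _ hx => hx.1)
      (fun x hx => mul_nonneg (hsq hx) (hkoebe hx)) (fun x _ => sq_nonneg _)
    refine (hprod.comp hgmono hg).congr fun y hy => ?_
    have := hf.deriv_pos _ (hg hy)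
    have := sub_pos.2 (hg hy).1
    have := (hsub (hg hy)).1
    simp only [Function.comp, Pi.mul_apply, hfg hy]
    field_simp
  · have hprod := antitoneOn_mul_of_nonneg (antitoneOn_mul_of_nonneg (hh.antitoneOn.mono hsub)
      hf.koebe_right (fun _ => hsq) (fun _ => hkoebe))
      ((antitoneOn_sub_div_one_sub_sq hq).mono fun _ hx => hx.2)
      (fun x hx => mul_nonneg (hsq hx) (hkoebe hx)) (fun x _ => sq_nonneg _)
    refine (hprod.comp_MonotoneOn hgmono hg).congr fun y hy => ?_
    have := hf.deriv_pos _ (hg hy)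
    have := sub_pos.2 (hg hy).2
    have := sub_pos.2 (hsub (hg hy)).2
    simp only [Function.comp, Pi.mul_apply, hfg hy]
    field_simp

end KoebeDensity

theorem map_withDensity_restrict {s : Set ℝ} {f g : ℝ → ℝ} (hf : Measurable f)
    (hs : MeasurableSet s) (hdiff : ∀ x ∈ s, DifferentiableAt ℝ f x)
    (hderiv : ∀ x ∈ s, deriv f x ≠ 0) (hg : LeftInvOn g f s) (h : ℝ → ℝ≥0∞) :
    ((volume.restrict s).withDensity h).map f =
      (volume.restrict (f '' s)).withDensity fun y => h (g y) / ENNReal.ofReal |deriv f (g y)| := by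
  ext A hA
  have hS : MeasurableSet (f ⁻¹' A ∩ s) := (hf hA).inter hs
  rw [Measure.map_apply hf hA, withDensity_apply _ (hf hA), Measure.restrict_restrict (hf hA),
    withDensity_apply _ hA, Measure.restrict_restrict hA, inter_comm A, ← image_inter_preimage,
    inter_comm s, lintegral_image_eq_lintegral_abs_deriv_mul hS
      (fun x hx => (hdiff x hx.2).hasDerivAt.hasDerivWithinAt)
      (hg.injOn.mono inter_subset_right)]
  refine setLIntegral_congr_fun hS fun x hx => ?_
  have hpos : 0 < |deriv f x| := abs_pos.2 (hderiv x hx.2)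
  simp only [hg hx.2]
  exact (ENNReal.mul_div_cancel (ENNReal.ofReal_pos.2 hpos).ne' ENNReal.ofReal_ne_top).symm

/-- Measures on `(0,1)` with a Koebe density. -/
def KoebeMeasure (κ : Measure ℝ) : Prop :=
  ∃ h, KoebeDensity h ∧ κ = unitLebesgue.withDensity fun x => ENNReal.ofReal (h x)

theorem koebeMeasure_unitLebesgue : KoebeMeasure unitLebesgue :=
  ⟨fun _ => 1, KoebeDensity.const zero_le_one, by simp⟩

namespace KoebeMeasure

variable {κ κ' : Measure ℝ}

theorem add (h : KoebeMeasure κ) (h' : KoebeMeasure κ') : KoebeMeasure (κ + κ') := by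
  obtain ⟨h, hh, rfl⟩ := h
  obtain ⟨k, hk, rfl⟩ := h'
  refine ⟨_, hh.add hk, ?_⟩
  ext A hA
  rw [Measure.add_apply, withDensity_apply _ hA, withDensity_apply _ hA, withDensity_apply _ hA,
    ← lintegral_add_left' hh.aemeasurable.ennreal_ofReal.restrict]
  refine lintegral_congr_ae (ae_restrict_of_ae
    ((ae_restrict_mem measurableSet_Ioo).mono fun x hx => ?_))
  exact (ENNReal.ofReal_add (hh.nonneg x hx) (hk.nonneg x hx)).symm

theorem absolutelyContinuous (h : KoebeMeasure κ) : κ ≪ unitLebesgue := by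
  obtain ⟨_, _, rfl⟩ := h
  exact withDensity_absolutelyContinuous _ _

theorem map_branch (h : KoebeMeasure κ) {p q : ℝ} {f : ℝ → ℝ} (hf : KoebeBranch p q f)
    (hmeas : Measurable f) (hp : 0 ≤ p) (hq : q ≤ 1) :
    KoebeMeasure ((κ.restrict (Ioo p q)).map f) := by
  obtain ⟨h, hh, rfl⟩ := h
  have hg : InvOn (Function.invFunOn f (Ioo p q)) f (Ioo p q) (Ioo 0 1) := hf.bijOn.invOn_invFunOn
  have hgmaps : MapsTo (Function.invFunOn f (Ioo p q)) (Ioo 0 1) (Ioo p q) :=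
    hf.bijOn.surjOn.mapsTo_invFunOn
  refine ⟨_, hh.transfer hf hp hq hgmaps hg.2, ?_⟩
  rw [restrict_withDensity measurableSet_Ioo, Measure.restrict_restrict measurableSet_Ioo,
    inter_eq_self_of_subset_left (Ioo_subset_Ioo hp hq), map_withDensity_restrict hmeas
      measurableSet_Ioo hf.differentiableAt (fun x hx => (hf.deriv_pos x hx).ne') hg.1,
    hf.bijOn.image_eq]
  refine withDensity_congr_ae ((ae_restrict_mem measurableSet_Ioo).mono fun y hy => ?_)
  have hpos := hf.deriv_pos _ (hgmaps hy)
  simp only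
  rw [abs_of_pos hpos, ENNReal.ofReal_div_of_pos hpos]

theorem smul_unitLebesgue_le (h : KoebeMeasure κ) {δ : ℝ} (hδ : 0 < δ) :
    (ENNReal.ofReal (δ ^ 2) * κ (Icc δ (1 - δ))) • unitLebesgue ≤ κ := by
  obtain ⟨h, hh, rfl⟩ := h
  rw [← withDensity_const]
  refine withDensity_mono ((ae_restrict_mem measurableSet_Ioo).mono fun y hy => ?_)
  rw [withDensity_apply _ measurableSet_Icc, ← lintegral_const_mul' _ _ ENNReal.ofReal_ne_top]
  calc ∫⁻ x in Icc δ (1 - δ), ENNReal.ofReal (δ ^ 2) * ENNReal.ofReal (h x) ∂unitLebesgue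
      ≤ ∫⁻ _ in Icc δ (1 - δ), ENNReal.ofReal (h y) ∂unitLebesgue := by
        refine setLIntegral_mono' measurableSet_Icc fun x hx => ?_
        rw [← ENNReal.ofReal_mul (sq_nonneg δ)]
        exact ENNReal.ofReal_le_ofReal (hh.harnack hδ hx hy)
    _ ≤ ENNReal.ofReal (h y) := by
        rw [setLIntegral_const]
        exact mul_le_of_le_one_right' prob_le_one

theorem smul_restrict_le (h : KoebeMeasure κ) {δ : ℝ} (hδ : 0 < δ) :
    ENNReal.ofReal (δ ^ 2) • κ.restrict (Icc δ (1 - δ)) ≤ κ univ • unitLebesgue := by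
  obtain ⟨h, hh, rfl⟩ := h
  rw [restrict_withDensity measurableSet_Icc, ← withDensity_smul' _ _ ENNReal.ofReal_ne_top]
  refine (withDensity_mono (g := fun _ => unitLebesgue.withDensity (fun x =>
    ENNReal.ofReal (h x)) univ) ((ae_restrict_mem measurableSet_Icc).mono fun x hx => ?_)).trans ?_
  · rw [withDensity_apply _ MeasurableSet.univ, Measure.restrict_univ]
    calc ENNReal.ofReal (δ ^ 2) * ENNReal.ofReal (h x)
        = ∫⁻ _, ENNReal.ofReal (δ ^ 2) * ENNReal.ofReal (h x) ∂unitLebesgue := by simp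
      _ ≤ ∫⁻ y, ENNReal.ofReal (h y) ∂unitLebesgue := by
          refine setLIntegral_mono' measurableSet_Ioo fun y hy => ?_
          rw [← ENNReal.ofReal_mul (sq_nonneg δ)]
          exact ENNReal.ofReal_le_ofReal (hh.harnack hδ hx hy)
  · rw [withDensity_const]
    gcongr
    exact Measure.restrict_le_self

theorem real_Icc_le [IsFiniteMeasure κ] (h : KoebeMeasure κ) {r c u : ℝ} (hr : 0 < r)
    (hc : c ∈ Icc r (1 - r)) (hu : 0 ≤ u) :
    κ.real (Icc (c - u) (c + u)) ≤ 8 / r ^ 2 * κ.real univ * u := by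
  rcases le_or_gt u (r / 2) with hur | hur
  · have hsub : Icc (c - u) (c + u) ⊆ Icc (r / 2) (1 - r / 2) :=
      Icc_subset_Icc (by linarith [hc.1]) (by linarith [hc.2])
    have hle := h.smul_restrict_le (half_pos hr) (Icc (c - u) (c + u))
    simp only [Measure.smul_apply, smul_eq_mul, Measure.restrict_apply measurableSet_Icc,
      inter_eq_self_of_subset_left hsub] at hle
    have hvol : volume (Icc (c - u) (c + u) ∩ Ioo 0 1) ≤ ENNReal.ofReal (2 * u) := by
      refine (measure_mono inter_subset_left).trans ?_
      rw [Real.volume_Icc]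
      exact ENNReal.ofReal_le_ofReal (by linarith)
    have hreal := ENNReal.toReal_mono (by finiteness)
      (hle.trans (mul_le_mul_right hvol (κ univ)))
    rw [ENNReal.toReal_mul, ENNReal.toReal_mul, ENNReal.toReal_ofReal (sq_nonneg _),
      ENNReal.toReal_ofReal (by linarith)] at hreal
    simp only [Measure.real]
    rw [div_mul_eq_mul_div, div_mul_eq_mul_div, le_div_iff₀ (by positivity)]
    linarith
  · calc κ.real (Icc (c - u) (c + u)) ≤ κ.real univ := measureReal_mono (subset_univ _)
      _ ≤ 8 * u / r ^ 2 * κ.real univ := by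
          refine le_mul_of_one_le_left measureReal_nonneg ?_
          rw [one_le_div (by positivity)]
          nlinarith [hc.1, hc.2]
      _ = 8 / r ^ 2 * κ.real univ * u := by ring

end KoebeMeasure

/-! ### Full Koebe maps and the mass of tails -/

/-- A measurable map of the line whose restrictions to `(0,c)` and `(c,1)` are both Koebe branches;
its values at other points are irrelevant. -/
structure FullKoebeMap (T : ℝ → ℝ) (c : ℝ) : Prop where
  measurable : Measurable T
  left : KoebeBranch 0 c T
  right : KoebeBranch c 1 T

theorem KoebeBranch.lt {p q : ℝ} {f : ℝ → ℝ} (h : KoebeBranch p q f) : p < q :=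
  let ⟨_, hx, _⟩ := h.bijOn.surjOn (⟨one_half_pos, one_half_lt_one⟩ : (1 / 2 : ℝ) ∈ Ioo 0 1)
  hx.1.trans hx.2

theorem unitLebesgue_compl_union (c : ℝ) : unitLebesgue (Ioo 0 c ∪ Ioo c 1)ᶜ = 0 := by
  rw [Measure.restrict_apply (measurableSet_Ioo.union measurableSet_Ioo).compl]
  refine measure_mono_null (t := {c}) (fun x hx => ?_) (by simp)
  rcases lt_trichotomy x c with hxc | hxc | hxc
  · exact absurd (Or.inl ⟨hx.2.1, hxc⟩) hx.1
  · exact hxc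
  · exact absurd (Or.inr ⟨hxc, hx.2.2⟩) hx.1

theorem disjoint_Ioo_Ioo (a b c : ℝ) : Disjoint (Ioo a b) (Ioo b c) :=
  disjoint_left.2 fun _ hx hx' => hx.2.not_gt hx'.1

theorem restrict_Ioo_add_restrict_Ioo {κ : Measure ℝ} (h : κ ≪ unitLebesgue) (c : ℝ) :
    κ.restrict (Ioo 0 c) + κ.restrict (Ioo c 1) = κ := by
  rw [← Measure.restrict_union (disjoint_Ioo_Ioo 0 c 1) measurableSet_Ioo]
  exact Measure.restrict_eq_self_of_ae_mem (h (unitLebesgue_compl_union c))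

theorem map_iterate_succ {X : Type*} [MeasurableSpace X] {T : X → X} (hT : Measurable T)
    (κ : Measure X) (n : ℕ) : κ.map T^[n + 1] = (κ.map T^[n]).map T := by
  rw [Measure.map_map hT (hT.iterate n), Function.iterate_succ']

namespace FullKoebeMap

variable {T : ℝ → ℝ} {c : ℝ} {κ : Measure ℝ}

theorem exists_branch {I : Set ℝ} (hT : FullKoebeMap T c) (hI : I = Ioo 0 c ∨ I = Ioo c 1) :
    ∃ p q, 0 ≤ p ∧ q ≤ 1 ∧ I = Ioo p q ∧ KoebeBranch p q T := by
  rcases hI with rfl | rfl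
  · exact ⟨0, c, le_rfl, hT.right.lt.le, rfl, hT.left⟩
  · exact ⟨c, 1, hT.left.lt.le, le_rfl, rfl, hT.right⟩

theorem koebeMeasure_map_branch {I : Set ℝ} (hT : FullKoebeMap T c)
    (hI : I = Ioo 0 c ∨ I = Ioo c 1) (h : KoebeMeasure κ) :
    KoebeMeasure ((κ.restrict I).map T) := by
  obtain ⟨p, q, hp, hq, rfl, hf⟩ := hT.exists_branch hI
  exact h.map_branch hf hT.measurable hp hq

theorem koebeMeasure_map (hT : FullKoebeMap T c) (h : KoebeMeasure κ) :
    KoebeMeasure (κ.map T) := by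
  rw [← restrict_Ioo_add_restrict_Ioo h.absolutelyContinuous c, Measure.map_add _ _ hT.measurable]
  exact (hT.koebeMeasure_map_branch (.inl rfl) h).add (hT.koebeMeasure_map_branch (.inr rfl) h)

theorem koebeMeasure_map_iterate (hT : FullKoebeMap T c) (h : KoebeMeasure κ) (n : ℕ) :
    KoebeMeasure (κ.map T^[n]) := by
  induction n with
  | zero => simpa using h
  | succ n ih => exact map_iterate_succ hT.measurable κ n ▸ hT.koebeMeasure_map ih

end FullKoebeMap

/-- A point which `T` maps into the `t`-tail `(t, 1 - t)ᶜ` of the unit interval lies either in the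
smaller `θ t`-tail or within `C t ^ β` of `c`. -/
def ExpandsTails (T : ℝ → ℝ) (c θ s C β : ℝ) : Prop :=
  ∀ x ∈ Ioo 0 c ∪ Ioo c 1, ∀ t ∈ Ioc 0 s, T x ∉ Ioo t (1 - t) →
    x ∉ Ioo (θ * t) (1 - θ * t) ∨ |x - c| ≤ C * t ^ β

/-- The geometric series `∑ (8 C / r²) θ ^ (β n)` of the masses entering the tails through the
critical point; the density of a normalized Koebe measure is at most `4 / r²` on
`[r / 2, 1 - r / 2]`. -/
def tailConst (r C θ β : ℝ) : ℝ := 8 / r ^ 2 * C / (1 - θ ^ β)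

namespace ExpandsTails

variable {T : ℝ → ℝ} {κ : Measure ℝ} {c r θ s C β t δ : ℝ}

theorem map_real_tail_le [IsFiniteMeasure κ] (hE : ExpandsTails T c θ s C β)
    (hT : Measurable T) (hC : 0 ≤ C) (hr : 0 < r) (hc : c ∈ Icc r (1 - r)) (h : KoebeMeasure κ)
    (ht : t ∈ Ioc 0 s) :
    (κ.map T).real (Ioo t (1 - t))ᶜ ≤
      κ.real (Ioo (θ * t) (1 - θ * t))ᶜ + 8 / r ^ 2 * κ.real univ * (C * t ^ β) := by
  have hsub : T ⁻¹' (Ioo t (1 - t))ᶜ ≤ᵐ[κ]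
      ((Ioo (θ * t) (1 - θ * t))ᶜ ∪ Icc (c - C * t ^ β) (c + C * t ^ β) : Set ℝ) := by
    filter_upwards [mem_ae_iff.2 (h.absolutelyContinuous (unitLebesgue_compl_union c))]
      with x hx hxT
    refine (hE x hx t ht hxT).imp id fun hxc => ?_
    exact mem_Icc_iff_abs_le.1 (abs_sub_comm x c ▸ hxc)
  rw [map_measureReal_apply hT measurableSet_Ioo.compl]
  calc κ.real (T ⁻¹' (Ioo t (1 - t))ᶜ)
      ≤ κ.real ((Ioo (θ * t) (1 - θ * t))ᶜ ∪ Icc (c - C * t ^ β) (c + C * t ^ β)) :=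
        ENNReal.toReal_mono (measure_ne_top _ _) (measure_mono_ae hsub)
    _ ≤ κ.real (Ioo (θ * t) (1 - θ * t))ᶜ + κ.real (Icc (c - C * t ^ β) (c + C * t ^ β)) :=
        measureReal_union_le _ _
    _ ≤ κ.real (Ioo (θ * t) (1 - θ * t))ᶜ + 8 / r ^ 2 * κ.real univ * (C * t ^ β) := by
        gcongr
        exact h.real_Icc_le hr hc (mul_nonneg hC (Real.rpow_nonneg ht.1.le β))

theorem map_iterate_real_tail_le [IsFiniteMeasure κ] (hE : ExpandsTails T c θ s C β)
    (hT : FullKoebeMap T c) (hθ : θ ∈ Ioo 0 1) (hC : 0 ≤ C) (hβ : 0 < β) (hr : 0 < r)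
    (hc : c ∈ Icc r (1 - r)) (h : KoebeMeasure κ) (n : ℕ) (ht : t ∈ Ioc 0 s) :
    (κ.map T^[n]).real (Ioo t (1 - t))ᶜ ≤
      κ.real (Ioo (θ ^ n * t) (1 - θ ^ n * t))ᶜ + tailConst r C θ β * κ.real univ * t ^ β := by
  have hgap : 0 < 1 - θ ^ β := sub_pos.2 (Real.rpow_lt_one hθ.1.le hθ.2 hβ)
  induction n generalizing t with
  | zero =>
    have : 0 ≤ tailConst r C θ β * κ.real univ * t ^ β := by
      have := Real.rpow_nonneg ht.1.le β
      unfold tailConst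
      positivity
    simpa using this
  | succ n ih =>
    have hθt : θ * t ∈ Ioc 0 s :=
      ⟨mul_pos hθ.1 ht.1, (mul_le_of_le_one_left ht.1.le hθ.2.le).trans ht.2⟩
    have hstep := hE.map_real_tail_le hT.measurable hC hr hc (hT.koebeMeasure_map_iterate h n) ht
    rw [← map_iterate_succ hT.measurable, map_measureReal_apply (hT.measurable.iterate n)
      MeasurableSet.univ, preimage_univ] at hstep
    calc (κ.map T^[n + 1]).real (Ioo t (1 - t))ᶜ
        ≤ (κ.map T^[n]).real (Ioo (θ * t) (1 - θ * t))ᶜ +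
            8 / r ^ 2 * κ.real univ * (C * t ^ β) := hstep
      _ ≤ κ.real (Ioo (θ ^ n * (θ * t)) (1 - θ ^ n * (θ * t)))ᶜ +
            tailConst r C θ β * κ.real univ * (θ * t) ^ β +
            8 / r ^ 2 * κ.real univ * (C * t ^ β) := by grw [ih hθt]
      _ = κ.real (Ioo (θ ^ (n + 1) * t) (1 - θ ^ (n + 1) * t))ᶜ +
            tailConst r C θ β * κ.real univ * t ^ β := by
          rw [pow_succ θ, mul_assoc (θ ^ n), Real.mul_rpow hθ.1.le ht.1.le, tailConst]
          field_simp
          ring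

end ExpandsTails

theorem unitLebesgue_real_tail_le {t : ℝ} (ht : 0 ≤ t) :
    unitLebesgue.real (Ioo t (1 - t))ᶜ ≤ 2 * t := by
  rw [measureReal_restrict_apply measurableSet_Ioo.compl]
  calc volume.real ((Ioo t (1 - t))ᶜ ∩ Ioo 0 1)
      ≤ volume.real (Icc 0 t ∪ Icc (1 - t) 1) := by
        refine measureReal_mono (fun x hx => ?_) (by simp)
        rcases le_or_gt x t with hxt | hxt
        · exact Or.inl ⟨hx.2.1.le, hxt⟩
        · exact Or.inr ⟨le_of_not_gt fun hlt => hx.1 ⟨hxt, hlt⟩, hx.2.2.le⟩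
    _ ≤ volume.real (Icc 0 t) + volume.real (Icc (1 - t) 1) := measureReal_union_le _ _
    _ = 2 * t := by
        rw [Real.volume_real_Icc_of_le ht, Real.volume_real_Icc_of_le (by linarith)]
        ring

theorem tendsto_measure_tail {κ : Measure ℝ} [IsFiniteMeasure κ] (h : κ ≪ unitLebesgue)
    {u : ℕ → ℝ} (hu : Antitone u) (hlim : Tendsto u atTop (𝓝 0)) :
    Tendsto (fun n => κ.real (Ioo (u n) (1 - u n))ᶜ) atTop (𝓝 0) := by
  have hanti : Antitone fun n => (Ioo (u n) (1 - u n))ᶜ := fun m n hmn =>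
    compl_subset_compl.2 (Ioo_subset_Ioo (hu hmn) (sub_le_sub_left (hu hmn) 1))
  have hinter : ⋂ n, (Ioo (u n) (1 - u n))ᶜ ⊆ (Ioo 0 1)ᶜ := fun x hx hx01 => by
    obtain ⟨n, hn, hn'⟩ := ((hlim.eventually (eventually_lt_nhds hx01.1)).and
      (hlim.eventually (eventually_lt_nhds (sub_pos.2 hx01.2)))).exists
    exact mem_iInter.1 hx n ⟨hn, by linarith⟩
  have hmeas := tendsto_measure_iInter_atTop (μ := κ)
    (fun n => (measurableSet_Ioo (a := u n) (b := 1 - u n)).compl.nullMeasurableSet) hanti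
    ⟨0, measure_ne_top _ _⟩
  rw [measure_mono_null hinter (h (by simp [Measure.restrict_apply]))] at hmeas
  exact (ENNReal.tendsto_toReal ENNReal.zero_ne_top).comp hmeas

/-- The mass of Koebe measures does not escape to the endpoints of the unit interval under
iteration of `T`: the iterates of Lebesgue measure are tight in `(0,1)`, and at most half of the
mass lies outside `(δ, 1 - δ)`, always for Lebesgue measure and at some time for any finite Koebe
measure. -/
structure HasTightOrbits (T : ℝ → ℝ) (δ : ℝ) : Prop where
  tight : ∀ ε : ℝ≥0∞, 0 < ε → ∃ t > 0, ∀ n, (unitLebesgue.map T^[n]) (Ioo t (1 - t))ᶜ ≤ ε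
  unitLebesgue_le : ∀ n, (unitLebesgue.map T^[n]).real (Ioo δ (1 - δ))ᶜ ≤ 1 / 2
  exists_le : ∀ κ, IsFiniteMeasure κ → KoebeMeasure κ →
    ∃ n, (κ.map T^[n]).real (Ioo δ (1 - δ))ᶜ ≤ κ.real univ / 2

theorem exists_two_mul_add_mul_rpow_le (D : ℝ) {β s ε : ℝ} (hβ : 0 < β) (hs : 0 < s) (hε : 0 < ε) :
    ∃ t ∈ Ioc 0 s, 2 * t + D * t ^ β ≤ ε := by
  have hcont : Tendsto (fun t : ℝ => 2 * t + D * t ^ β) (𝓝 0) (𝓝 (2 * 0 + D * 0 ^ β)) :=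
    ((continuous_const.mul continuous_id).add
      (continuous_const.mul (Real.continuous_rpow_const hβ.le))).tendsto 0
  rw [Real.zero_rpow hβ.ne', mul_zero, mul_zero, add_zero] at hcont
  obtain ⟨t, ht, hle⟩ := ((eventually_mem_set.2 (Ioc_mem_nhdsGT hs)).and
    ((hcont.mono_left nhdsWithin_le_nhds).eventually (eventually_le_nhds hε))).exists
  exact ⟨t, ht, hle⟩

theorem ExpandsTails.hasTightOrbits {T : ℝ → ℝ} {c r θ s C β δ : ℝ}
    (hE : ExpandsTails T c θ s C β) (hT : FullKoebeMap T c) (hθ : θ ∈ Ioo 0 1) (hC : 0 ≤ C)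
    (hβ : 0 < β) (hr : 0 < r) (hc : c ∈ Icc r (1 - r)) (hδ : δ ∈ Ioc 0 s)
    (hδle : 2 * δ + tailConst r C θ β * δ ^ β ≤ 1 / 4) : HasTightOrbits T δ := by
  have hlebesgue : ∀ n, ∀ t ∈ Ioc 0 s, (unitLebesgue.map T^[n]).real (Ioo t (1 - t))ᶜ ≤
      2 * t + tailConst r C θ β * t ^ β := fun n t ht => by
    have htail := hE.map_iterate_real_tail_le hT hθ hC hβ hr hc koebeMeasure_unitLebesgue n ht
    have hle := unitLebesgue_real_tail_le (mul_pos (pow_pos hθ.1 n) ht.1).le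
    have hmul := mul_le_of_le_one_left ht.1.le (pow_le_one₀ (n := n) hθ.1.le hθ.2.le)
    rw [probReal_univ, mul_one] at htail
    linarith
  refine ⟨fun ε hε => ?_, fun n => (hlebesgue n δ hδ).trans (by linarith), fun κ _ h => ?_⟩
  · obtain ⟨e, he, heε⟩ := ENNReal.lt_iff_exists_nnreal_btwn.1 hε
    obtain ⟨t, ht, hte⟩ := exists_two_mul_add_mul_rpow_le (tailConst r C θ β) hβ
      (hδ.1.trans_le hδ.2) (NNReal.coe_pos.2 (ENNReal.coe_pos.1 he))
    refine ⟨t, ht.1, fun n => le_trans ?_ heε.le⟩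
    rw [← ENNReal.ofReal_coe_nnreal]
    exact (ENNReal.le_ofReal_iff_toReal_le (measure_ne_top _ _) e.2).2
      ((hlebesgue n t ht).trans hte)
  · rcases (measureReal_nonneg (μ := κ) (s := univ)).eq_or_lt with hzero | hpos
    · refine ⟨0, ?_⟩
      have := measureReal_mono (μ := κ) (subset_univ (Ioo δ (1 - δ))ᶜ)
      rw [Function.iterate_zero, Measure.map_id]
      linarith
    · have hanti : Antitone fun n : ℕ => θ ^ n * δ := fun m n hmn =>
        mul_le_mul_of_nonneg_right (pow_le_pow_of_le_one hθ.1.le hθ.2.le hmn) hδ.1.le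
      have hlim : Tendsto (fun n : ℕ => θ ^ n * δ) atTop (𝓝 0) := by
        simpa using (tendsto_pow_atTop_nhds_zero_of_lt_one hθ.1.le hθ.2).mul_const δ
      obtain ⟨n, hn⟩ := ((tendsto_measure_tail h.absolutelyContinuous hanti hlim).eventually
        (eventually_le_nhds (show 0 < κ.real univ / 4 by linarith))).exists
      refine ⟨n, (hE.map_iterate_real_tail_le hT hθ hC hβ hr hc h n hδ).trans ?_⟩
      nlinarith [hδ.1]

/-! ### Setwise limits and invariant measures -/

section SetwiseLimit

variable {X ι : Type*} [MeasurableSpace X] {ν : ι → Measure X} {ρ : Measure X}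

/-- The `ε`-`η` form of absolute continuity, uniformly over a family of measures. -/
def UniformlyAbsCont (ν : ι → Measure X) (ρ : Measure X) : Prop :=
  ∀ ε : ℝ≥0∞, 0 < ε → ∃ η : ℝ≥0∞, 0 < η ∧ ∀ A, MeasurableSet A → ρ A ≤ η → ∀ i, ν i A ≤ ε

namespace UniformlyAbsCont

/-- Limits along an ultrafilter exist by compactness of `[0, ∞]` and are finitely additive; uniform
absolute continuity makes them continuous at `∅`, hence countably additive. -/
theorem exists_tendsto_ultrafilter [IsFiniteMeasure ρ] (h : UniformlyAbsCont ν ρ) {M : ℝ≥0}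
    (hM : ∀ i, ν i univ ≤ M) (U : Ultrafilter ι) :
    ∃ μ : Measure X, ∀ A, MeasurableSet A → Tendsto (fun i => ν i A) U (𝓝 (μ A)) := by
  have hring : IsSetRing {A : Set X | MeasurableSet A} :=
    ⟨.empty, fun _ _ => .union, fun _ _ => .diff⟩
  let L : Set X → ℝ≥0∞ := fun A => (U.map fun i => ν i A).lim
  have hL : ∀ A, Tendsto (fun i => ν i A) U (𝓝 (L A)) := fun A => Ultrafilter.le_nhds_lim _
  have hLempty : L ∅ = 0 := tendsto_nhds_unique (hL ∅) (by simp)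
  let m : AddContent ℝ≥0∞ {A : Set X | MeasurableSet A} := hring.addContent_of_union L hLempty
    fun {A B} _ hB hAB => tendsto_nhds_unique (hL (A ∪ B))
      (((hL A).add (hL B)).congr fun i => (measure_union hAB hB).symm)
  have hfin : ∀ A ∈ {A : Set X | MeasurableSet A}, m A ≠ ∞ := fun A _ =>
    ne_top_of_le_ne_top ENNReal.coe_ne_top (le_of_tendsto' (hL A) fun i =>
      (measure_mono (subset_univ A)).trans (hM i))
  have hzero : ∀ ⦃A : ℕ → Set X⦄, (∀ n, A n ∈ {A : Set X | MeasurableSet A}) → Antitone A →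
      ⋂ n, A n = ∅ → Tendsto (fun n => m (A n)) atTop (𝓝 0) := fun A hA hanti hinter => by
    have hρ := tendsto_measure_iInter_atTop (μ := ρ) (fun n => (hA n).nullMeasurableSet) hanti
      ⟨0, measure_ne_top _ _⟩
    rw [hinter, measure_empty] at hρ
    refine ENNReal.tendsto_nhds_zero.2 fun ε hε => ?_
    obtain ⟨η, hη, hsmall⟩ := h ε hε
    filter_upwards [ENNReal.tendsto_nhds_zero.1 hρ η hη] with n hn
    exact le_of_tendsto' (hL (A n)) (hsmall _ (hA n) hn)
  refine ⟨Measure.ofMeasurable (fun A _ => m A) addContent_empty fun A hA hdisj =>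
    addContent_iUnion_eq_sum_of_tendsto_zero hring m hfin hzero hA (.iUnion hA) hdisj,
    fun A hA => ?_⟩
  rw [Measure.ofMeasurable_apply A hA]
  exact hL A

theorem absolutelyContinuous_of_tendsto (h : UniformlyAbsCont ν ρ) {l : Filter ι} [l.NeBot]
    {μ : Measure X} (hμ : ∀ A, MeasurableSet A → Tendsto (fun i => ν i A) l (𝓝 (μ A))) :
    μ ≪ ρ := by
  refine Measure.AbsolutelyContinuous.mk fun A hA hρ => ?_
  refine nonpos_iff_eq_zero.1 (le_of_forall_gt_imp_ge_of_dense fun ε hε => ?_)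
  obtain ⟨η, -, hsmall⟩ := h ε hε
  exact le_of_tendsto' (hμ A hA) (hsmall A hA (hρ.trans_le zero_le))

end UniformlyAbsCont

end SetwiseLimit

section Cesaro

variable {X : Type*} [MeasurableSpace X] {T : X → X} {κ ρ : Measure X}

/-- The average of the first `n + 1` push-forwards of `κ` under `T`. -/
def cesaroAverage (T : X → X) (κ : Measure X) (n : ℕ) : Measure X :=
  ((n + 1 : ℕ) : ℝ≥0∞)⁻¹ • ∑ k ∈ Finset.range (n + 1), κ.map T^[k]

theorem cesaroAverage_apply (n : ℕ) (A : Set X) : cesaroAverage T κ n A =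
    ((n + 1 : ℕ) : ℝ≥0∞)⁻¹ * ∑ k ∈ Finset.range (n + 1), κ.map T^[k] A := by
  simp [cesaroAverage]

theorem cesaroAverage_apply_le {b : ℝ≥0∞} {A : Set X} (h : ∀ n, κ.map T^[n] A ≤ b) (n : ℕ) :
    cesaroAverage T κ n A ≤ b := by
  rw [cesaroAverage_apply, mul_comm, ← div_eq_mul_inv]
  refine ENNReal.div_le_of_le_mul' ?_
  simpa using Finset.sum_le_card_nsmul (Finset.range (n + 1)) _ b fun k _ => h k

theorem le_cesaroAverage_apply {b : ℝ≥0∞} {A : Set X} (h : ∀ n, b ≤ κ.map T^[n] A) (n : ℕ) :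
    b ≤ cesaroAverage T κ n A := by
  rw [cesaroAverage_apply, mul_comm, ← div_eq_mul_inv,
    ENNReal.le_div_iff_mul_le (Or.inl (by simp)) (Or.inl (ENNReal.natCast_ne_top _)), mul_comm]
  simpa using Finset.card_nsmul_le_sum (Finset.range (n + 1)) _ b fun k _ => h k

theorem UniformlyAbsCont.cesaroAverage (h : UniformlyAbsCont (fun n => κ.map T^[n]) ρ) :
    UniformlyAbsCont (cesaroAverage T κ) ρ := fun ε hε =>
  let ⟨η, hη, hsmall⟩ := h ε hε
  ⟨η, hη, fun A hA hAη => cesaroAverage_apply_le (hsmall A hA hAη)⟩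

theorem map_cesaroAverage_add (hT : Measurable T) (n : ℕ) :
    (cesaroAverage T κ n).map T + ((n + 1 : ℕ) : ℝ≥0∞)⁻¹ • κ =
      cesaroAverage T κ n + ((n + 1 : ℕ) : ℝ≥0∞)⁻¹ • κ.map T^[n + 1] := by
  have hmap : (cesaroAverage T κ n).map T =
      ((n + 1 : ℕ) : ℝ≥0∞)⁻¹ • ∑ k ∈ Finset.range (n + 1), κ.map T^[k + 1] := by
    rw [Lorenz.cesaroAverage, Measure.map_smul, ← Measure.mapₗ_apply_of_measurable hT, map_sum]
    simp only [Measure.mapₗ_apply_of_measurable hT, map_iterate_succ hT]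
  have hsum := Finset.sum_range_succ' (fun k => κ.map T^[k]) (n + 1)
  simp only [Function.iterate_zero, Measure.map_id] at hsum
  rw [hmap, Lorenz.cesaroAverage, ← smul_add, ← smul_add, ← hsum, Finset.sum_range_succ]

theorem tendsto_inv_succ_mul {b : ℕ → ℝ≥0∞} {M : ℝ≥0∞} (hM : M ≠ ∞) (hb : ∀ n, b n ≤ M) :
    Tendsto (fun n => ((n + 1 : ℕ) : ℝ≥0∞)⁻¹ * b n) atTop (𝓝 0) := by
  have hlim : Tendsto (fun n : ℕ => ((n + 1 : ℕ) : ℝ≥0∞)⁻¹ * M) atTop (𝓝 0) := by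
    simpa using ENNReal.Tendsto.mul_const
      (ENNReal.tendsto_inv_nat_nhds_zero.comp (tendsto_add_atTop_nat 1)) (Or.inr hM)
  exact tendsto_of_tendsto_of_tendsto_of_le_of_le tendsto_const_nhds hlim (fun _ => zero_le)
    fun n => by gcongr; exact hb n

theorem map_eq_self_of_tendsto_cesaroAverage [IsFiniteMeasure κ] (hT : Measurable T)
    {l : Filter ℕ} [l.NeBot] (hl : l ≤ atTop) {μ : Measure X}
    (hμ : ∀ A, MeasurableSet A → Tendsto (fun n => cesaroAverage T κ n A) l (𝓝 (μ A))) :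
    μ.map T = μ := by
  ext A hA
  have hterm : ∀ k : ℕ → ℕ, Tendsto
      (fun n => (((n + 1 : ℕ) : ℝ≥0∞)⁻¹ • κ.map T^[k n]) A) l (𝓝 0) := fun k => by
    refine (tendsto_inv_succ_mul (measure_ne_top κ univ) fun n => ?_).mono_left hl
    change κ.map T^[k n] A ≤ κ univ
    rw [Measure.map_apply (hT.iterate _) hA]
    exact measure_mono (subset_univ _)
  have hlim := (hμ A hA).add (hterm fun n => n + 1)
  simp only [← Measure.add_apply, ← map_cesaroAverage_add hT] at hlim
  rw [Measure.map_apply hT hA, ← add_zero (μ (T ⁻¹' A)), ← add_zero (μ A)]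
  refine tendsto_nhds_unique ((hμ _ (hT hA)).add (hterm fun _ => 0)) (hlim.congr fun n => ?_)
  rw [Measure.add_apply, Measure.map_apply hT hA, Function.iterate_zero, Measure.map_id]

theorem exists_measurePreserving_of_uniformlyAbsCont [IsProbabilityMeasure κ] [IsFiniteMeasure ρ]
    (hT : Measurable T) (h : UniformlyAbsCont (fun n => κ.map T^[n]) ρ) :
    ∃ μ : Measure X, IsProbabilityMeasure μ ∧ MeasurePreserving T μ μ ∧ μ ≪ ρ ∧
      ∀ σ : Measure X, (∀ n, σ ≤ κ.map T^[n]) → σ ≤ μ := by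
  have huniv : ∀ n, κ.map T^[n] univ = 1 := fun n => by
    rw [Measure.map_apply (hT.iterate n) .univ, preimage_univ, measure_univ]
  have hle : ∀ n, cesaroAverage T κ n univ ≤ 1 :=
    cesaroAverage_apply_le fun n => (huniv n).le
  obtain ⟨μ, hμ⟩ := h.cesaroAverage.exists_tendsto_ultrafilter (M := 1) (by simpa using hle)
    (hyperfilter ℕ)
  refine ⟨μ, ⟨le_antisymm (le_of_tendsto' (hμ _ .univ) hle) ?_⟩,
    ⟨hT, map_eq_self_of_tendsto_cesaroAverage hT Nat.hyperfilter_le_atTop hμ⟩,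
    h.cesaroAverage.absolutelyContinuous_of_tendsto hμ, fun σ hσ => ?_⟩
  · exact ge_of_tendsto' (hμ _ .univ) (le_cesaroAverage_apply fun n => (huniv n).ge)
  · exact Measure.le_iff.2 fun A hA =>
      ge_of_tendsto' (hμ A hA) (le_cesaroAverage_apply fun n => hσ n A)

end Cesaro

/-! ### The invariant measure of a full Koebe map -/

theorem KoebeMeasure.smul_unitLebesgue_le_of_tail_le {κ : Measure ℝ} [IsFiniteMeasure κ]
    (h : KoebeMeasure κ) {δ : ℝ} (hδ : 0 < δ)
    (htail : κ.real (Ioo δ (1 - δ))ᶜ ≤ κ.real univ / 2) :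
    (ENNReal.ofReal (δ ^ 2 / 2) * κ univ) • unitLebesgue ≤ κ := by
  refine le_trans ?_ (h.smul_unitLebesgue_le hδ)
  have hhalf : κ.real univ / 2 ≤ κ.real (Icc δ (1 - δ)) := by
    have hsplit := measureReal_add_measureReal_compl (μ := κ)
      (measurableSet_Ioo (a := δ) (b := 1 - δ))
    have hmono := measureReal_mono (μ := κ) (Ioo_subset_Icc_self (a := δ) (b := 1 - δ))
    linarith
  gcongr ?_ • _
  rw [← ENNReal.ofReal_toReal (measure_ne_top κ univ),
    ← ENNReal.ofReal_toReal (measure_ne_top κ (Icc δ (1 - δ))),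
    ← ENNReal.ofReal_mul (by positivity), ← ENNReal.ofReal_mul (by positivity)]
  refine ENNReal.ofReal_le_ofReal ?_
  simp only [Measure.real] at hhalf
  nlinarith [sq_nonneg δ]

theorem KoebeMeasure.unitLebesgue_absolutelyContinuous {κ : Measure ℝ} (h : KoebeMeasure κ)
    (hκ : κ ≠ 0) : unitLebesgue ≪ κ := by
  obtain ⟨n, hn⟩ : ∃ n : ℕ, κ (Icc (1 / (n + 1) : ℝ) (1 - 1 / (n + 1))) ≠ 0 := by
    by_contra! hzero
    refine hκ (Measure.measure_univ_eq_zero.1 (measure_mono_null (t := (Ioo 0 1)ᶜ ∪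
      ⋃ n : ℕ, Icc (1 / (n + 1) : ℝ) (1 - 1 / (n + 1))) (fun x _ => ?_) (measure_union_null
      (h.absolutelyContinuous (by simp [Measure.restrict_apply])) (measure_iUnion_null hzero))))
    by_cases hx : x ∈ Ioo (0 : ℝ) 1
    · obtain ⟨n, hn⟩ := exists_nat_one_div_lt (lt_min hx.1 (sub_pos.2 hx.2))
      rw [lt_min_iff] at hn
      exact Or.inr (mem_iUnion.2 ⟨n, hn.1.le, by linarith⟩)
    · exact Or.inl hx
  refine (Measure.absolutelyContinuous_smul (mul_ne_zero ?_ hn)).trans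
    (h.smul_unitLebesgue_le (Nat.one_div_pos_of_nat (n := n))).absolutelyContinuous
  exact (ENNReal.ofReal_pos.2 (by positivity)).ne'

namespace FullKoebeMap

variable {T : ℝ → ℝ} {c δ : ℝ} {κ μ : Measure ℝ}

theorem uniformlyAbsCont (hT : FullKoebeMap T c) (hO : HasTightOrbits T δ) :
    UniformlyAbsCont (fun n => unitLebesgue.map T^[n]) unitLebesgue := fun ε hε => by
  obtain ⟨t, ht, htail⟩ := hO.tight (ε / 2) (ENNReal.half_pos hε.ne')
  have ht2 : ENNReal.ofReal (t ^ 2) ≠ 0 := (ENNReal.ofReal_pos.2 (by positivity)).ne'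
  refine ⟨ENNReal.ofReal (t ^ 2) * (ε / 2), ENNReal.mul_pos ht2 (ENNReal.half_pos hε.ne').ne',
    fun A hA hsmall n => ?_⟩
  have hcore : (unitLebesgue.map T^[n]).restrict (Icc t (1 - t)) A ≤ ε / 2 := by
    refine (ENNReal.mul_le_mul_iff_right ht2 ENNReal.ofReal_ne_top).1 (le_trans ?_ hsmall)
    have hle := (hT.koebeMeasure_map_iterate koebeMeasure_unitLebesgue n).smul_restrict_le ht A
    rw [Measure.map_apply (hT.measurable.iterate n) .univ, preimage_univ, measure_univ,
      one_smul] at hle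
    exact hle
  rw [Measure.restrict_apply hA] at hcore
  calc unitLebesgue.map T^[n] A
      ≤ unitLebesgue.map T^[n] ((Ioo t (1 - t))ᶜ ∪ A ∩ Icc t (1 - t)) := by
        refine measure_mono fun x hx => ?_
        by_cases hxt : x ∈ Ioo t (1 - t)
        · exact Or.inr ⟨hx, Ioo_subset_Icc_self hxt⟩
        · exact Or.inl hxt
    _ ≤ ε / 2 + ε / 2 := (measure_union_le _ _).trans (add_le_add (htail n) hcore)
    _ = ε := ENNReal.add_halves ε

theorem exists_measurePreserving (hT : FullKoebeMap T c) (hδ : 0 < δ) (hO : HasTightOrbits T δ) :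
    ∃ μ : Measure ℝ, IsProbabilityMeasure μ ∧ MeasurePreserving T μ μ ∧ μ ≪ unitLebesgue ∧
      ENNReal.ofReal (δ ^ 2 / 2) • unitLebesgue ≤ μ := by
  obtain ⟨μ, hprob, hinv, hac, hle⟩ :=
    exists_measurePreserving_of_uniformlyAbsCont hT.measurable (hT.uniformlyAbsCont hO)
  refine ⟨μ, hprob, hinv, hac, hle _ fun n => ?_⟩
  have := Measure.isProbabilityMeasure_map (μ := unitLebesgue)
    (hT.measurable.iterate n).aemeasurable
  have hle := (hT.koebeMeasure_map_iterate koebeMeasure_unitLebesgue n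
    ).smul_unitLebesgue_le_of_tail_le hδ (by simpa using hO.unitLebesgue_le n)
  rwa [measure_univ, mul_one] at hle

theorem mul_unitLebesgue_le_of_preimage_eq (hT : FullKoebeMap T c) (hδ : 0 < δ)
    (hO : HasTightOrbits T δ) [IsFiniteMeasure κ] (h : KoebeMeasure κ) {A : Set ℝ}
    (hA : MeasurableSet A) (hTA : T ⁻¹' A = A) :
    ENNReal.ofReal (δ ^ 2 / 2) * κ univ * unitLebesgue A ≤ κ A := by
  obtain ⟨n, hn⟩ := hO.exists_le κ inferInstance h
  have hiter : T^[n] ⁻¹' A = A := by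
    rw [preimage_iterate_eq]
    exact Function.iterate_fixed hTA n
  have huniv : κ.map T^[n] univ = κ univ := by
    rw [Measure.map_apply (hT.measurable.iterate n) .univ, preimage_univ]
  have hle := (hT.koebeMeasure_map_iterate h n).smul_unitLebesgue_le_of_tail_le hδ
    (by simpa only [Measure.real, huniv] using hn) A
  rwa [huniv, Measure.map_apply (hT.measurable.iterate n) hA, hiter] at hle

theorem unitLebesgue_absolutelyContinuous_map_branch {I : Set ℝ} (hT : FullKoebeMap T c)
    (hI : I = Ioo 0 c ∨ I = Ioo c 1) : unitLebesgue ≪ (unitLebesgue.restrict I).map T := by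
  refine (hT.koebeMeasure_map_branch hI koebeMeasure_unitLebesgue
    ).unitLebesgue_absolutelyContinuous fun hzero => ?_
  obtain ⟨p, q, hp, hq, rfl, hf⟩ := hT.exists_branch hI
  rw [Measure.map_eq_zero_iff hT.measurable.aemeasurable, Measure.restrict_eq_zero,
    Measure.restrict_apply measurableSet_Ioo,
    inter_eq_self_of_subset_left (Ioo_subset_Ioo hp hq), Real.volume_Ioo,
    ENNReal.ofReal_eq_zero] at hzero
  linarith [hf.lt]

end FullKoebeMap

/-- The domains of the branches of `T^[m]`. -/
inductive IsCylinder (T : ℝ → ℝ) (c : ℝ) : ℕ → Set ℝ → Prop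
  | zero : IsCylinder T c 0 (Ioo 0 1)
  | succ {m : ℕ} {I J : Set ℝ} (hI : I = Ioo 0 c ∨ I = Ioo c 1) (hJ : IsCylinder T c m J) :
    IsCylinder T c (m + 1) (I ∩ T ⁻¹' J)

namespace IsCylinder

variable {T : ℝ → ℝ} {c : ℝ} {m : ℕ} {J : Set ℝ} {κ μ : Measure ℝ}

theorem subset_Ioo (hT : FullKoebeMap T c) (hJ : IsCylinder T c m J) : J ⊆ Ioo 0 1 := by
  cases hJ with
  | zero => exact subset_rfl
  | succ hI hJ =>
    obtain ⟨p, q, hp, hq, rfl, -⟩ := hT.exists_branch hI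
    exact inter_subset_left.trans (Ioo_subset_Ioo hp hq)

theorem ordConnected (hT : FullKoebeMap T c) (hJ : IsCylinder T c m J) : J.OrdConnected := by
  induction hJ with
  | zero => exact ordConnected_Ioo
  | succ hI _ ih =>
    obtain ⟨p, q, -, -, rfl, hf⟩ := hT.exists_branch hI
    refine ⟨fun x hx y hy z hz => ?_⟩
    have hzI : z ∈ Ioo p q := ordConnected_Ioo.out hx.1 hy.1 hz
    exact ⟨hzI, ih.out hx.2 hy.2 ⟨hf.monotoneOn hx.1 hzI hz.1, hf.monotoneOn hzI hy.1 hz.2⟩⟩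

theorem measurableSet (hT : FullKoebeMap T c) (hJ : IsCylinder T c m J) : MeasurableSet J :=
  (hJ.ordConnected hT).measurableSet

theorem unitLebesgue_ne_zero (hT : FullKoebeMap T c) (hJ : IsCylinder T c m J) :
    unitLebesgue J ≠ 0 := by
  induction hJ with
  | zero => simp
  | succ hI hJ ih =>
    intro hzero
    refine ih (hT.unitLebesgue_absolutelyContinuous_map_branch hI ?_)
    have hmeas := hT.measurable (hJ.measurableSet hT)
    rwa [Measure.map_apply hT.measurable (hJ.measurableSet hT), Measure.restrict_apply hmeas,
      inter_comm]

theorem koebeMeasure_map_iterate (hT : FullKoebeMap T c) (hJ : IsCylinder T c m J)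
    (h : KoebeMeasure κ) : KoebeMeasure ((κ.restrict J).map T^[m]) := by
  induction hJ generalizing κ with
  | zero =>
    rw [Function.iterate_zero, Measure.map_id, Measure.restrict_eq_self_of_ae_mem]
    · exact h
    · exact h.absolutelyContinuous (ae_restrict_mem measurableSet_Ioo)
  | @succ m I J hI hJ ih =>
    have hmap := ih (hT.koebeMeasure_map_branch hI h)
    rwa [Measure.restrict_map hT.measurable (hJ.measurableSet hT),
      Measure.restrict_restrict (hT.measurable (hJ.measurableSet hT)), inter_comm,
      Measure.map_map (hT.measurable.iterate m) hT.measurable, ← Function.iterate_succ] at hmap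

theorem ae_exists_mem (hT : MeasurePreserving T μ μ) (hμ : μ ≪ unitLebesgue) (m : ℕ) :
    ∀ᵐ x ∂μ, ∃ J, IsCylinder T c m J ∧ x ∈ J := by
  induction m with
  | zero =>
    filter_upwards [hμ (ae_restrict_mem measurableSet_Ioo)] with x hx using ⟨_, .zero, hx⟩
  | succ m ih =>
    filter_upwards [mem_ae_iff.2 (hμ (unitLebesgue_compl_union c)),
      hT.quasiMeasurePreserving.ae ih] with x hx ⟨J, hJ, hxJ⟩
    rcases hx with hx | hx
    · exact ⟨_, .succ (.inl rfl) hJ, hx, hxJ⟩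
    · exact ⟨_, .succ (.inr rfl) hJ, hx, hxJ⟩

end IsCylinder

theorem exists_pos_forall_measure_lt {X : Type*} [MeasurableSpace X] {μ σ : Measure X}
    [IsFiniteMeasure μ] [SigmaFinite σ] (h : μ ≪ σ) {r : ℝ≥0∞} (hr : r ≠ 0) :
    ∃ ρ > 0, ∀ A, σ A < ρ → μ A < r := by
  have hfin : ∫⁻ x, μ.rnDeriv σ x ∂σ ≠ ∞ := (Measure.lintegral_rnDeriv_lt_top μ σ).ne
  simpa only [Measure.setLIntegral_rnDeriv h] using exists_pos_setLIntegral_lt_of_measure_lt hfin hr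

theorem exists_ae_eq_closedBall_of_ordConnected {J : Set ℝ} (hJ : J.OrdConnected)
    (hbdd : Bornology.IsBounded J) (hpos : volume J ≠ 0) :
    ∃ w δ, 0 < δ ∧ J ⊆ Metric.closedBall w δ ∧ J =ᵐ[volume] Metric.closedBall w δ := by
  have hconn : IsConnected J := ⟨nonempty_of_measure_ne_zero hpos, hJ.isPreconnected⟩
  have hsub : J ⊆ Icc (sInf J) (sSup J) := subset_Icc_csInf_csSup hbdd.bddBelow hbdd.bddAbove
  have hIcc : J =ᵐ[volume] Icc (sInf J) (sSup J) :=
    hsub.eventuallyLE.antisymm (Ioo_ae_eq_Icc.symm.le.trans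
      (hconn.Ioo_csInf_csSup_subset hbdd.bddBelow hbdd.bddAbove).eventuallyLE)
  refine ⟨(sInf J + sSup J) / 2, (sSup J - sInf J) / 2, ?_, ?_⟩
  · rw [measure_congr hIcc, Real.volume_Icc, ← pos_iff_ne_zero, ENNReal.ofReal_pos] at hpos
    exact half_pos hpos
  · rw [← Real.Icc_eq_closedBall]
    exact ⟨hsub, hIcc⟩

theorem volume_eq_zero_of_ae_forall_exists_ordConnected {S : Set ℝ} {a : ℝ≥0∞} (ha : a < 1)
    (h : ∀ᵐ x ∂volume.restrict S, ∀ ε > 0, ∃ J, x ∈ J ∧ J.OrdConnected ∧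
      Bornology.IsBounded J ∧ volume J ≠ 0 ∧ volume J ≤ ε ∧ volume (S ∩ J) ≤ a * volume J) :
    volume S = 0 := by
  rw [← Measure.restrict_eq_zero, ← ae_eq_bot, ← eventually_false_iff_eq_bot]
  filter_upwards [h, IsUnifLocDoublingMeasure.ae_tendsto_measure_inter_div volume S 1]
    with x hx hdensity
  have hball : ∀ n : ℕ, ∃ w δ, 0 < δ ∧ δ ≤ ((n + 1 : ℕ) : ℝ)⁻¹ ∧ x ∈ Metric.closedBall w δ ∧
      volume (S ∩ Metric.closedBall w δ) ≤ a * volume (Metric.closedBall w δ) := fun n => by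
    obtain ⟨J, hxJ, hJ, hbdd, hpos, hsmall, hprop⟩ :=
      hx (ENNReal.ofReal ((n + 1 : ℕ) : ℝ)⁻¹) (ENNReal.ofReal_pos.2 (by positivity))
    obtain ⟨w, δ, hδ, hsub, hae⟩ := exists_ae_eq_closedBall_of_ordConnected hJ hbdd hpos
    rw [measure_congr hae, Real.volume_closedBall,
      ENNReal.ofReal_le_ofReal_iff (by positivity)] at hsmall
    rw [measure_congr hae, measure_congr (EventuallyEq.rfl.inter hae)] at hprop
    exact ⟨w, δ, hδ, by linarith, hsub hxJ, hprop⟩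
  choose w δ hδ hδle hmem hprop using hball
  have hδlim : Tendsto δ atTop (𝓝[>] 0) := tendsto_nhdsWithin_iff.2
    ⟨squeeze_zero (fun n => (hδ n).le) hδle
      (tendsto_inv_atTop_nhds_zero_nat.comp (tendsto_add_atTop_nat 1)), .of_forall hδ⟩
  have hlim := hdensity w δ hδlim (.of_forall fun n => by simpa using hmem n)
  refine ha.not_ge (le_of_tendsto' hlim fun n => ENNReal.div_le_of_le_mul (hprop n))

theorem FullKoebeMap.exists_pos_le_measure_branch {T : ℝ → ℝ} {c : ℝ} {μ : Measure ℝ}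
    [IsFiniteMeasure μ] (hT : FullKoebeMap T c) (hμ : μ ≪ unitLebesgue) (hμ' : unitLebesgue ≪ μ)
    {r : ℝ≥0∞} (hr : r ≠ 0) : ∃ ρ > 0, ∀ I, I = Ioo 0 c ∨ I = Ioo c 1 → ∀ A, MeasurableSet A →
      r ≤ μ A → ρ ≤ μ (I ∩ T ⁻¹' A) := by
  have hbranch : ∀ I, I = Ioo 0 c ∨ I = Ioo c 1 →
      ∃ ρ > 0, ∀ A, MeasurableSet A → r ≤ μ A → ρ ≤ μ (I ∩ T ⁻¹' A) := fun I hI => by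
    have hac : μ ≪ (μ.restrict I).map T :=
      (hμ.trans (hT.unitLebesgue_absolutelyContinuous_map_branch hI)).trans
        ((hμ'.restrict I).map hT.measurable)
    obtain ⟨ρ, hρ, hlt⟩ := exists_pos_forall_measure_lt hac hr
    refine ⟨ρ, hρ, fun A hA hrA => ?_⟩
    rw [inter_comm, ← Measure.restrict_apply (hT.measurable hA),
      ← Measure.map_apply hT.measurable hA]
    exact le_of_not_gt fun hρA => (hlt A hρA).not_ge hrA
  obtain ⟨ρ, hρ, hleft⟩ := hbranch _ (.inl rfl)
  obtain ⟨ρ', hρ', hright⟩ := hbranch _ (.inr rfl)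
  refine ⟨min ρ ρ', lt_min hρ hρ', ?_⟩
  rintro I (rfl | rfl) A hA hrA
  · exact (min_le_left _ _).trans (hleft A hA hrA)
  · exact (min_le_right _ _).trans (hright A hA hrA)

namespace IsCylinder

variable {T : ℝ → ℝ} {c : ℝ} {m : ℕ} {J : Set ℝ} {μ : Measure ℝ}

/-- Each preimage loses to the other branch a definite part of the mass of `J`. -/
theorem measure_add_mul_le_one [IsProbabilityMeasure μ] (hT : FullKoebeMap T c)
    (hμT : MeasurePreserving T μ μ) {r ρ : ℝ≥0∞} (hρ : ∀ I, I = Ioo 0 c ∨ I = Ioo c 1 →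
      ∀ A, MeasurableSet A → r ≤ μ A → ρ ≤ μ (I ∩ T ⁻¹' A))
    (hJ : IsCylinder T c m J) (hr : r ≤ μ J) : μ J + m * ρ ≤ 1 := by
  induction hJ with
  | zero => simpa using prob_le_one
  | @succ m I J hI hJ ih =>
    have hJmeas := hJ.measurableSet hT
    obtain ⟨I', hI', hdisj⟩ : ∃ I', (I' = Ioo 0 c ∨ I' = Ioo c 1) ∧ Disjoint I I' := by
      rcases hI with rfl | rfl
      · exact ⟨_, .inr rfl, disjoint_Ioo_Ioo 0 c 1⟩
      · exact ⟨_, .inl rfl, (disjoint_Ioo_Ioo 0 c 1).symm⟩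
    have hrJ : r ≤ μ J := hr.trans ((measure_mono inter_subset_right).trans_eq
      (hμT.measure_preimage hJmeas.nullMeasurableSet))
    calc μ (I ∩ T ⁻¹' J) + (m + 1 : ℕ) * ρ = μ (I ∩ T ⁻¹' J) + ρ + m * ρ := by
          push_cast; ring
      _ ≤ μ (I ∩ T ⁻¹' J) + μ (I' ∩ T ⁻¹' J) + m * ρ := by
          gcongr
          exact hρ I' hI' J hJmeas hrJ
      _ = μ (I ∩ T ⁻¹' J ∪ I' ∩ T ⁻¹' J) + m * ρ := by
          rw [measure_union (hdisj.mono inter_subset_left inter_subset_left)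
            ((hI'.elim (· ▸ measurableSet_Ioo) (· ▸ measurableSet_Ioo)).inter
              (hT.measurable hJmeas))]
      _ ≤ μ (T ⁻¹' J) + m * ρ := by
          gcongr
          exact union_subset inter_subset_right inter_subset_right
      _ = μ J + m * ρ := by rw [hμT.measure_preimage hJmeas.nullMeasurableSet]
      _ ≤ 1 := ih hrJ

theorem exists_forall_unitLebesgue_lt [IsProbabilityMeasure μ] (hT : FullKoebeMap T c)
    (hμT : MeasurePreserving T μ μ) (hμ : μ ≪ unitLebesgue) (hμ' : unitLebesgue ≪ μ)
    {ε : ℝ≥0∞} (hε : ε ≠ 0) : ∃ m, ∀ J, IsCylinder T c m J → unitLebesgue J < ε := by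
  obtain ⟨r, hr, hlt⟩ := exists_pos_forall_measure_lt hμ' hε
  obtain ⟨ρ, hρ, hle⟩ := hT.exists_pos_le_measure_branch hμ hμ' hr.ne'
  obtain ⟨m, -, hm⟩ := ENNReal.exists_nat_pos_mul_gt hρ.ne' ENNReal.one_ne_top
  refine ⟨m, fun J hJ => hlt J (lt_of_not_ge fun hrJ => hm.not_ge ?_)⟩
  exact le_add_self.trans (hJ.measure_add_mul_le_one hT hμT hle hrJ)

end IsCylinder

namespace FullKoebeMap

variable {T : ℝ → ℝ} {c δ : ℝ} {μ : Measure ℝ}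

/-- `T^[m]` maps `J` onto the unit interval with bounded distortion, so that an invariant set takes
up a definite proportion of `J`. -/
theorem unitLebesgue_compl_inter_le (hT : FullKoebeMap T c) (hδ : 0 < δ)
    (hO : HasTightOrbits T δ) {A : Set ℝ} (hA : MeasurableSet A) (hTA : T ⁻¹' A = A) {m : ℕ}
    {J : Set ℝ} (hJ : IsCylinder T c m J) :
    unitLebesgue (Aᶜ ∩ J) ≤
      (1 - ENNReal.ofReal (δ ^ 2 / 2) * unitLebesgue A) * unitLebesgue J := by
  have hiter : T^[m] ⁻¹' A = A := by
    rw [preimage_iterate_eq]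
    exact Function.iterate_fixed hTA m
  have hle := hT.mul_unitLebesgue_le_of_preimage_eq hδ hO
    (hJ.koebeMeasure_map_iterate hT koebeMeasure_unitLebesgue) hA hTA
  rw [Measure.map_apply (hT.measurable.iterate m) .univ, preimage_univ,
    Measure.restrict_apply_univ, Measure.map_apply (hT.measurable.iterate m) hA, hiter,
    Measure.restrict_apply (μ := unitLebesgue) hA, mul_right_comm] at hle
  rw [ENNReal.sub_mul (fun _ _ => measure_ne_top _ _), one_mul]
  refine ENNReal.le_sub_of_add_le_left (ne_top_of_le_ne_top (measure_ne_top _ _) hle) ?_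
  grw [hle]
  rw [inter_comm, inter_comm Aᶜ, ← sdiff_eq, measure_inter_add_sdiff J hA]

theorem ergodic [IsProbabilityMeasure μ] (hT : FullKoebeMap T c) (hδ : 0 < δ)
    (hO : HasTightOrbits T δ) (hμT : MeasurePreserving T μ μ) (hμ : μ ≪ unitLebesgue)
    (hμ' : unitLebesgue ≪ μ) : Ergodic T μ := by
  refine ⟨hμT, ⟨fun A hA hTA => ?_⟩⟩
  rw [eventuallyConst_set']
  by_cases hzero : unitLebesgue A = 0
  · exact .inl (ae_eq_empty.2 (hμ hzero))
  refine .inr (ae_eq_univ.2 (hμ ?_))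
  have hvol : ∀ S, unitLebesgue S = volume (S ∩ Ioo 0 1) := fun S =>
    Measure.restrict_apply' measurableSet_Ioo
  have hlt : 1 - ENNReal.ofReal (δ ^ 2 / 2) * unitLebesgue A < 1 :=
    ENNReal.sub_lt_self ENNReal.one_ne_top one_ne_zero
      (mul_ne_zero (ENNReal.ofReal_pos.2 (by positivity)).ne' hzero)
  rw [hvol]
  refine volume_eq_zero_of_ae_forall_exists_ordConnected hlt ?_
  rw [← Measure.restrict_restrict hA.compl]
  refine ae_restrict_of_ae ?_
  filter_upwards [hμ' (ae_all_iff.2 fun m => IsCylinder.ae_exists_mem hμT hμ m)] with x hx ε hε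
  obtain ⟨m, hm⟩ := IsCylinder.exists_forall_unitLebesgue_lt hT hμT hμ hμ' hε.ne'
  obtain ⟨J, hJ, hxJ⟩ := hx m
  have hJvol : unitLebesgue J = volume J := by
    rw [hvol, inter_eq_self_of_subset_left (hJ.subset_Ioo hT)]
  refine ⟨J, hxJ, hJ.ordConnected hT, (Metric.isBounded_Ioo 0 1).subset (hJ.subset_Ioo hT),
    hJvol ▸ hJ.unitLebesgue_ne_zero hT, hJvol ▸ (hm J hJ).le, ?_⟩
  rw [inter_right_comm, ← hvol, ← hJvol]
  exact hT.unitLebesgue_compl_inter_le hδ hO hA hTA hJ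

theorem exists_ergodic (hT : FullKoebeMap T c) (hδ : 0 < δ) (hO : HasTightOrbits T δ) :
    ∃ μ : Measure ℝ, IsProbabilityMeasure μ ∧ Ergodic T μ ∧ μ ≪ unitLebesgue ∧
      unitLebesgue ≪ μ ∧ ENNReal.ofReal (δ ^ 2 / 2) • unitLebesgue ≤ μ := by
  obtain ⟨μ, hprob, hinv, hac, hle⟩ := hT.exists_measurePreserving hδ hO
  have hac' : unitLebesgue ≪ μ :=
    (Measure.absolutelyContinuous_smul (ENNReal.ofReal_pos.2 (by positivity)).ne').trans
      hle.absolutelyContinuous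
  exact ⟨μ, hprob, hT.ergodic hδ hO hinv hac hac', hac, hac', hle⟩

end FullKoebeMap

/-! ### Lorenz maps -/

namespace IsDiffeoPart

variable {φ : ℝ → ℝ}

theorem hasDerivAt_iteratedDerivWithin (h : IsDiffeoPart φ) {k : ℕ} (hk : k < 3) {x : ℝ}
    (hx : x ∈ Ioo 0 1) :
    HasDerivAt (iteratedDerivWithin k φ (Icc 0 1)) (iteratedDerivWithin (k + 1) φ (Icc 0 1) x)
      x := by
  rw [iteratedDerivWithin_succ]
  exact (h.contDiffOn.differentiableOn_iteratedDerivWithin (mod_cast hk)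
    (uniqueDiffOn_Icc one_pos) x (Ioo_subset_Icc_self hx)).hasDerivWithinAt.hasDerivAt
      (Icc_mem_nhds hx.1 hx.2)

theorem hasDerivAt (h : IsDiffeoPart φ) {x : ℝ} (hx : x ∈ Ioo 0 1) :
    HasDerivAt φ (iteratedDerivWithin 1 φ (Icc 0 1) x) x := by
  simpa using h.hasDerivAt_iteratedDerivWithin three_pos hx

theorem hasNonposSchwarzian (h : IsDiffeoPart φ) :
    HasNonposSchwarzian (Icc 0 1) φ (iteratedDerivWithin 1 φ (Icc 0 1))
      (fun x => iteratedDerivWithin 2 φ (Icc 0 1) x / iteratedDerivWithin 1 φ (Icc 0 1) x)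
      (fun x => iteratedDerivWithin 3 φ (Icc 0 1) x / iteratedDerivWithin 1 φ (Icc 0 1) x -
        (iteratedDerivWithin 2 φ (Icc 0 1) x / iteratedDerivWithin 1 φ (Icc 0 1) x) ^ 2) := by
  have hcont : ∀ {k : ℕ}, k ≤ 3 → ContinuousOn (iteratedDerivWithin k φ (Icc 0 1)) (Icc 0 1) :=
    fun hk => h.contDiffOn.continuousOn_iteratedDerivWithin (mod_cast hk) (uniqueDiffOn_Icc one_pos)
  have hne : ∀ x ∈ Icc (0 : ℝ) 1, iteratedDerivWithin 1 φ (Icc 0 1) x ≠ 0 := fun x hx =>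
    (h.deriv_pos x hx).ne'
  refine ⟨h.contDiffOn.continuousOn, hcont (by norm_num),
    (hcont (by norm_num)).div (hcont (by norm_num)) hne, ?_, ?_, ?_, h.deriv_pos, ?_⟩ <;>
    rw [interior_Icc] <;> intro x hx <;> have hnex := hne x (Ioo_subset_Icc_self hx)
  · exact h.hasDerivAt hx
  · rw [mul_div_cancel₀ _ hnex]
    exact h.hasDerivAt_iteratedDerivWithin (by norm_num) hx
  · refine ((h.hasDerivAt_iteratedDerivWithin (by norm_num) hx).div
      (h.hasDerivAt_iteratedDerivWithin (by norm_num) hx) hnex).congr_deriv ?_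
    field_simp
  · have := h.schwarzian_nonpos x (Ioo_subset_Icc_self hx)
    rw [schwarzian] at this
    linarith

theorem map_zero (h : IsDiffeoPart φ) : φ 0 = 0 := by
  have h0 : (0 : ℝ) ∈ Icc (0 : ℝ) 1 := left_mem_Icc.2 zero_le_one
  obtain ⟨x, hx, hx0⟩ := h.bijOn.surjOn h0
  have hmono := (h.hasNonposSchwarzian.strictMonoOn (convex_Icc 0 1)).monotoneOn h0 hx hx.1
  exact le_antisymm (hx0 ▸ hmono) (h.bijOn.mapsTo h0).1

theorem map_one (h : IsDiffeoPart φ) : φ 1 = 1 := by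
  have h1 : (1 : ℝ) ∈ Icc (0 : ℝ) 1 := right_mem_Icc.2 zero_le_one
  obtain ⟨x, hx, hx1⟩ := h.bijOn.surjOn h1
  have hmono := (h.hasNonposSchwarzian.strictMonoOn (convex_Icc 0 1)).monotoneOn hx h1 hx.2
  exact le_antisymm (h.bijOn.mapsTo h1).2 (hx1.symm.le.trans hmono)

theorem koebeBranch (h : IsDiffeoPart φ) : KoebeBranch 0 1 φ :=
  h.hasNonposSchwarzian.koebeBranch one_pos h.map_zero h.map_one

theorem mul_sub_le_sub (h : IsDiffeoPart φ) {a : ℝ}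
    (ha : ∀ x ∈ Icc (0 : ℝ) 1, a ≤ iteratedDerivWithin 1 φ (Icc 0 1) x) {x y : ℝ}
    (hx : x ∈ Icc 0 1) (hy : y ∈ Icc 0 1) (hxy : x ≤ y) : a * (y - x) ≤ φ y - φ x := by
  refine (convex_Icc (0 : ℝ) 1).mul_sub_le_image_sub_of_le_deriv h.contDiffOn.continuousOn
    ?_ ?_ x hx y hy hxy <;> rw [interior_Icc] <;> intro z hz
  · exact (h.hasDerivAt hz).differentiableAt.differentiableWithinAt
  · rw [(h.hasDerivAt hz).deriv]
    exact ha z (Ioo_subset_Icc_self hz)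

theorem mul_le (h : IsDiffeoPart φ) {a : ℝ}
    (ha : ∀ x ∈ Icc (0 : ℝ) 1, a ≤ iteratedDerivWithin 1 φ (Icc 0 1) x) {z : ℝ}
    (hz : z ∈ Icc 0 1) : a * z ≤ φ z := by
  simpa [h.map_zero] using h.mul_sub_le_sub ha (left_mem_Icc.2 zero_le_one) hz hz.1

theorem mul_one_sub_le (h : IsDiffeoPart φ) {a : ℝ}
    (ha : ∀ x ∈ Icc (0 : ℝ) 1, a ≤ iteratedDerivWithin 1 φ (Icc 0 1) x) {z : ℝ}
    (hz : z ∈ Icc 0 1) : a * (1 - z) ≤ 1 - φ z := by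
  simpa [h.map_one] using h.mul_sub_le_sub ha hz (right_mem_Icc.2 zero_le_one) hz.2

end IsDiffeoPart

theorem exists_forall_le_mul_of_mul_one_sub_rpow_le {a α : ℝ} (hα : 0 < α) (ha : 1 < a * α) :
    ∃ θ ∈ Ioo 0 1, ∃ s > 0, ∀ t ≤ s, ∀ y ∈ Icc 0 1, a * (1 - (1 - y) ^ α) ≤ t → y ≤ θ * t := by
  have ha0 : 0 < a := pos_of_mul_pos_left (one_pos.trans ha) hα.le
  obtain ⟨b, hb, hbα⟩ := exists_between ha
  have hderiv : HasDerivAt (fun y : ℝ => a * (1 - (1 - y) ^ α)) (a * α) 0 := by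
    have := ((Real.hasDerivAt_rpow_const (x := 1 - 0) (p := α) (.inl (by norm_num))).comp 0
      ((hasDerivAt_id (0 : ℝ)).const_sub 1)).const_sub 1
    exact (this.const_mul a).congr_deriv (by simp)
  obtain ⟨s, hs, hbound⟩ : ∃ s ∈ Ioo 0 1, ∀ y ∈ Ioc 0 s, b * y ≤ a * (1 - (1 - y) ^ α) := by
    have hslope := hderiv.tendsto_slope_zero_right.eventually (eventually_gt_nhds hbα)
    obtain ⟨u, hu, hsub⟩ := mem_nhdsGT_iff_exists_Ioc_subset.1 hslope
    refine ⟨min u (1 / 2), ⟨lt_min hu one_half_pos, (min_le_right _ _).trans_lt one_half_lt_one⟩,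
      fun y hy => ?_⟩
    have hby := hsub ⟨hy.1, hy.2.trans (min_le_left _ _)⟩
    simp only [mem_ofPred_eq, zero_add, sub_zero, Real.one_rpow, sub_self, mul_zero, smul_eq_mul,
      inv_mul_eq_div, lt_div_iff₀ hy.1] at hby
    exact hby.le
  have hb0 : 0 < b := one_pos.trans hb
  refine ⟨b⁻¹, ⟨inv_pos.2 hb0, inv_lt_one_of_one_lt₀ hb⟩, s, hs.1, fun t ht y hy hyt => ?_⟩
  rw [inv_mul_eq_div, le_div_iff₀' hb0]
  rcases hy.1.eq_or_lt with rfl | hy0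
  · simpa using hyt
  rcases le_or_gt y s with hys | hsy
  · exact (hbound y ⟨hy0, hys⟩).trans hyt
  · have hmono : (1 - y) ^ α ≤ (1 - s) ^ α :=
      Real.rpow_le_rpow (sub_nonneg.2 hy.2) (by linarith) hα.le
    have hs' := hbound s ⟨hs.1, le_rfl⟩
    nlinarith [hs.1]

theorem le_mul_rpow_of_mul_rpow_le {a α z t : ℝ} (ha : 0 < a) (hα : 0 < α) (hz : 0 ≤ z)
    (h : a * z ^ α ≤ t) : z ≤ (1 / a) ^ (1 / α) * t ^ (1 / α) := by
  have hzα := Real.rpow_nonneg hz α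
  have ht : 0 ≤ t := (mul_nonneg ha.le hzα).trans h
  rw [← Real.mul_rpow (by positivity) ht]
  calc z = (z ^ α) ^ (1 / α) := by rw [one_div, Real.rpow_rpow_inv hz hα.ne']
    _ ≤ (1 / a * t) ^ (1 / α) := by
        gcongr
        rwa [one_div, inv_mul_eq_div, le_div_iff₀' ha]

/-- For a branch rescaled to `[0,1]`, with fixed point `0` and critical point `1`, whose value at
`y` is `G`. -/
theorem le_mul_or_one_sub_le_mul_rpow {a α θ s t y G : ℝ} (ha : 0 < a) (hα : 0 < α)
    (hexp : ∀ t ≤ s, ∀ y ∈ Icc 0 1, a * (1 - (1 - y) ^ α) ≤ t → y ≤ θ * t) (ht : t ≤ s)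
    (hy : y ∈ Icc 0 1) (hG : a * (1 - (1 - y) ^ α) ≤ G) (hG' : a * (1 - y) ^ α ≤ 1 - G)
    (hGt : G ∉ Ioo t (1 - t)) : y ≤ θ * t ∨ 1 - y ≤ (1 / a) ^ (1 / α) * t ^ (1 / α) := by
  rcases not_and_or.1 hGt with hGt | hGt
  · exact .inl (hexp t ht y hy (hG.trans (not_lt.1 hGt)))
  · exact .inr (le_mul_rpow_of_mul_rpow_le ha hα (sub_nonneg.2 hy.2) (by linarith))

theorem rpow_mem_unitInterval {x α : ℝ} (hx : x ∈ Icc 0 1) (hα : 0 ≤ α) : x ^ α ∈ Icc 0 1 :=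
  ⟨Real.rpow_nonneg hx.1 α, Real.rpow_le_one hx.1 hx.2 hα⟩

theorem eq_one_of_mul_eq_one {x y : ℝ} (hx : x ∈ Icc 0 1) (hy : y ≤ 1) (h : x * y = 1) : x = 1 :=
  le_antisymm hx.2 (h ▸ mul_le_of_le_one_right hx.1 hy)

theorem mul_sub_le_measureReal_Icc {μ : Measure ℝ} [IsFiniteMeasure μ] {κ : ℝ} (hκ : 0 ≤ κ)
    (h : ENNReal.ofReal κ • unitLebesgue ≤ μ) {x y : ℝ} (hx : 0 ≤ x) (hy : y ≤ 1) :
    κ * (y - x) ≤ μ.real (Icc x y) := by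
  have hvol : unitLebesgue (Ioo x y) = ENNReal.ofReal (y - x) := by
    rw [Measure.restrict_apply measurableSet_Ioo,
      inter_eq_self_of_subset_left (Ioo_subset_Ioo hx hy), Real.volume_Ioo]
  have hle := (h (Ioo x y)).trans (measure_mono Ioo_subset_Icc_self)
  rw [Measure.smul_apply, hvol, smul_eq_mul, ← ENNReal.ofReal_mul hκ] at hle
  exact (ENNReal.ofReal_le_iff_le_toReal (measure_ne_top _ _)).1 hle

end Lorenz

namespace LorenzMap

open Lorenz

variable {α : ℝ} {f : LorenzMap α}

/-- The values of `f` on `[0,1] \ {c}` are all that matters; setting `f` to zero at `c` and outside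
`(0,1)` makes it a measurable map of the line. -/
def zeroExtension (f : LorenzMap α) : ℝ → ℝ := (Ioo 0 f.c ∪ Ioo f.c 1).indicator f.toFun

theorem eqOn_zeroExtension (f : LorenzMap α) :
    EqOn f.zeroExtension f.toFun (Ioo 0 f.c ∪ Ioo f.c 1) := fun _ hx => indicator_of_mem hx _

namespace IsFull

theorem u_eq_one (hα : 0 ≤ α) (h : f.IsFull) : f.u = 1 := by
  obtain ⟨x, hx, hfx⟩ := h.1.superset (right_mem_Icc.2 zero_le_one)
  have hpow := rpow_mem_unitInterval (unitInterval.div_mem (sub_nonneg.2 hx.2) f.c_mem.1.le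
    (sub_le_self _ hx.1)) hα
  have hone := Icc.one_sub_mem hpow
  refine eq_one_of_mul_eq_one f.u_mem hone.2 (f.diffeo_left.bijOn.injOn
    (unitInterval.mul_mem f.u_mem hone) (right_mem_Icc.2 zero_le_one) ?_)
  exact hfx.trans f.diffeo_left.map_one.symm

theorem v_eq_one (hα : 0 ≤ α) (h : f.IsFull) : f.v = 1 := by
  obtain ⟨x, hx, hfx⟩ := h.2.superset (left_mem_Icc.2 zero_le_one)
  have hpow := rpow_mem_unitInterval (unitInterval.div_mem (sub_nonneg.2 hx.1)
    (sub_nonneg.2 f.c_mem.2.le) (sub_le_sub_right hx.2 _)) hα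
  have hone := Icc.one_sub_mem hpow
  have hstd : stdRight α f.c f.v x = 1 - f.v * (1 - ((x - f.c) / (1 - f.c)) ^ α) := by
    rw [stdRight]
    ring
  have hzero : 1 - f.v * (1 - ((x - f.c) / (1 - f.c)) ^ α) = 0 :=
    f.diffeo_right.bijOn.injOn
      (Icc.one_sub_mem (unitInterval.mul_mem f.v_mem hone))
      (left_mem_Icc.2 zero_le_one) (hstd ▸ hfx.trans f.diffeo_right.map_zero.symm)
  exact eq_one_of_mul_eq_one f.v_mem hone.2 (sub_eq_zero.1 hzero).symm

theorem zeroExtension_left (hα : 0 ≤ α) (h : f.IsFull) {x : ℝ} (hx : x ∈ Ioo 0 f.c) :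
    f.zeroExtension x = f.φl (1 - (1 - x / f.c) ^ α) := by
  rw [f.eqOn_zeroExtension (.inl hx), toFun, lorenzFun, if_pos hx.2, leftBranch, stdLeft,
    h.u_eq_one hα, one_mul, sub_div, div_self f.c_mem.1.ne']

theorem zeroExtension_right (hα : 0 ≤ α) (h : f.IsFull) {x : ℝ} (hx : x ∈ Ioo f.c 1) :
    f.zeroExtension x = f.φr (((x - f.c) / (1 - f.c)) ^ α) := by
  rw [f.eqOn_zeroExtension (.inr hx), toFun, lorenzFun, if_neg hx.1.not_gt, rightBranch, stdRight,
    h.v_eq_one hα, one_mul, add_neg_cancel_left]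

theorem koebeBranch_left (hα : 1 ≤ α) (h : f.IsFull) : KoebeBranch 0 f.c f.zeroExtension := by
  refine (f.diffeo_left.koebeBranch.comp ((KoebeBranch.rpow hα).reflect.comp
    (KoebeBranch.affine f.c_mem.1))).congr fun x hx => ?_
  simp only [h.zeroExtension_left (by linarith) hx, Function.comp_apply, sub_zero]

theorem koebeBranch_right (hα : 1 ≤ α) (h : f.IsFull) : KoebeBranch f.c 1 f.zeroExtension :=
  (f.diffeo_right.koebeBranch.comp ((KoebeBranch.rpow hα).comp
    (KoebeBranch.affine f.c_mem.2))).congr fun _ hx => h.zeroExtension_right (by linarith) hx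

theorem fullKoebeMap (hα : 1 ≤ α) (h : f.IsFull) : FullKoebeMap f.zeroExtension f.c := by
  classical
  have hleft := h.koebeBranch_left hα
  have hright := h.koebeBranch_right hα
  have hcont : ContinuousOn f.zeroExtension (Ioo 0 f.c ∪ Ioo f.c 1) := fun x hx =>
    (hx.elim (hleft.differentiableAt x)
      (hright.differentiableAt x)).continuousAt.continuousWithinAt
  refine ⟨?_, hleft, hright⟩
  rw [zeroExtension, ← piecewise_eq_indicator]
  exact (hcont.congr f.eqOn_zeroExtension.symm).measurable_piecewise continuousOn_const
    (measurableSet_Ioo.union measurableSet_Ioo)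

/-- A one-sided neighbourhood of `c` of size `t` is mapped to one of `0` or `1` of size of the order
`t ^ α`, and the fixed points `0` and `1` are uniformly expanding. -/
theorem expandsTails {a θ s : ℝ} (hα : 0 < α) (ha : 0 < a)
    (hexp : ∀ t ≤ s, ∀ y ∈ Icc 0 1, a * (1 - (1 - y) ^ α) ≤ t → y ≤ θ * t) (h : f.IsFull)
    (hl : ∀ x ∈ Icc (0 : ℝ) 1, a ≤ iteratedDerivWithin 1 f.φl (Icc 0 1) x)
    (hr : ∀ x ∈ Icc (0 : ℝ) 1, a ≤ iteratedDerivWithin 1 f.φr (Icc 0 1) x) :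
    ExpandsTails f.zeroExtension f.c θ s ((1 / a) ^ (1 / α)) (1 / α) := by
  have hc := f.c_mem.1
  have hc1 := sub_pos.2 f.c_mem.2
  have hcle := f.c_mem.2.le
  rintro x (hx | hx) t ht hxt
  · have hy : x / f.c ∈ Icc 0 1 := unitInterval.div_mem hx.1.le hc.le hx.2.le
    have hp := Icc.one_sub_mem (rpow_mem_unitInterval (Icc.one_sub_mem hy) hα.le)
    rw [h.zeroExtension_left hα.le hx] at hxt
    refine (le_mul_or_one_sub_le_mul_rpow ha hα hexp ht.2 hy (f.diffeo_left.mul_le hl hp)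
      (by simpa using f.diffeo_left.mul_one_sub_le hl hp) hxt).imp (fun hyt hxθ => ?_) fun hyt => ?_
    · exact hxθ.1.not_ge ((le_div_self hx.1.le hc hcle).trans hyt)
    · calc |x - f.c| = f.c - x := by rw [abs_sub_comm, abs_of_pos (sub_pos.2 hx.2)]
        _ ≤ (f.c - x) / f.c := le_div_self (sub_nonneg.2 hx.2.le) hc hcle
        _ = 1 - x / f.c := by rw [sub_div, div_self hc.ne']
        _ ≤ _ := hyt
  · have hz : (x - f.c) / (1 - f.c) ∈ Icc 0 1 :=
      unitInterval.div_mem (sub_nonneg.2 hx.1.le) hc1.le (sub_le_sub_right hx.2.le _)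
    have hp := rpow_mem_unitInterval hz hα.le
    have hy : 1 - (x - f.c) / (1 - f.c) = (1 - x) / (1 - f.c) := by
      field_simp
      ring
    rw [h.zeroExtension_right hα.le hx] at hxt
    refine (le_mul_or_one_sub_le_mul_rpow ha hα hexp ht.2 (Icc.one_sub_mem hz)
      (by simpa using f.diffeo_right.mul_one_sub_le hr hp)
      (by simpa using f.diffeo_right.mul_le hr hp)
      fun hmem => hxt ⟨by linarith [hmem.2], by linarith [hmem.1]⟩).imp
      (fun hyt hxθ => ?_) fun hyt => ?_
    · have := (le_div_self (sub_nonneg.2 hx.2.le) hc1 (sub_le_self 1 hc.le)).trans (hy ▸ hyt)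
      linarith [hxθ.2]
    · rw [sub_sub_cancel] at hyt
      rw [abs_of_pos (sub_pos.2 hx.1)]
      exact (le_div_self (sub_nonneg.2 hx.1.le) hc1 (sub_le_self 1 hc.le)).trans hyt

end IsFull

theorem isACIP_iff (hf : Measurable f.zeroExtension) {μ : Measure ℝ} :
    f.IsACIP μ ↔ IsProbabilityMeasure μ ∧ μ ≪ unitLebesgue ∧
      MeasurePreserving f.zeroExtension μ μ := by
  have hres : volume.restrict (Icc (0 : ℝ) 1) = unitLebesgue :=
    Measure.restrict_congr_set Ioo_ae_eq_Icc.symm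
  have hsub : Ioo 0 f.c ∪ Ioo f.c 1 ⊆ Icc (0 : ℝ) 1 \ {f.c} := by
    rintro x (hx | hx)
    · exact ⟨⟨hx.1.le, (hx.2.trans f.c_mem.2).le⟩, hx.2.ne⟩
    · exact ⟨⟨(f.c_mem.1.trans hx.1).le, hx.2.le⟩, hx.1.ne'⟩
  have hset : μ ≪ unitLebesgue → ∀ A : Set ℝ,
      μ {x ∈ Icc (0 : ℝ) 1 \ {f.c} | f.toFun x ∈ A} = μ (f.zeroExtension ⁻¹' A) := fun hμ A => by
    refine measure_congr ?_
    filter_upwards [mem_ae_iff.2 (hμ (unitLebesgue_compl_union f.c))] with x hx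
    refine propext ?_
    change x ∈ Icc (0 : ℝ) 1 \ {f.c} ∧ f.toFun x ∈ A ↔ f.zeroExtension x ∈ A
    rw [f.eqOn_zeroExtension hx, and_iff_right (hsub hx)]
  constructor
  · rintro ⟨hprob, hac, hinv⟩
    rw [hres] at hac
    refine ⟨hprob, hac, hf, Measure.ext fun A hA => ?_⟩
    rw [Measure.map_apply hf hA, ← hset hac A, hinv A hA]
  · rintro ⟨hprob, hac, hinv⟩
    refine ⟨hprob, by rwa [hres], fun A hA => ?_⟩
    rw [hset hac A, hinv.measure_preimage hA.nullMeasurableSet]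

theorem IsFull.exists_forall_isACIP_iff_eq {δ : ℝ} (hα : 1 ≤ α) (h : f.IsFull) (hδ : 0 < δ)
    (hO : HasTightOrbits f.zeroExtension δ) :
    ∃ μ, (∀ ν, f.IsACIP ν ↔ ν = μ) ∧ ENNReal.ofReal (δ ^ 2 / 2) • unitLebesgue ≤ μ := by
  have hT := h.fullKoebeMap hα
  obtain ⟨μ, hprob, herg, hac, hac', hle⟩ := hT.exists_ergodic hδ hO
  refine ⟨μ, fun ν => ⟨fun hν => ?_, ?_⟩, hle⟩
  · obtain ⟨hνprob, hνac, hνinv⟩ := (isACIP_iff hT.measurable).1 hν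
    exact herg.eq_of_absolutelyContinuous hνinv (hνac.trans hac')
  · rintro rfl
    exact (isACIP_iff hT.measurable).2 ⟨hprob, hac, herg.toMeasurePreserving⟩

end LorenzMap

end

open Lorenz in
theorem mainTheorem6_general (α : ℝ) (hα : 1 ≤ α) {a : ℝ} (ha : 1 < a * α) {r : ℝ} (hr : 0 < r) :
    ∃ w : ℝ, 0 < w ∧
      ∀ f : LorenzMap α, f.IsFull →
        (∀ x ∈ Icc (0 : ℝ) 1, a ≤ iteratedDerivWithin 1 f.φl (Icc 0 1) x) →
        (∀ x ∈ Icc (0 : ℝ) 1, a ≤ iteratedDerivWithin 1 f.φr (Icc 0 1) x) →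
        f.c ∈ Icc r (1 - r) →
          (∃! μ : Measure ℝ, f.IsACIP μ) ∧
          ∀ μ : Measure ℝ, f.IsACIP μ → w ≤ μ.real (Icc 0 f.c) ∧ w ≤ μ.real (Icc f.c 1) := by
  have hα0 : 0 < α := one_pos.trans_le hα
  have ha0 : 0 < a := pos_of_mul_pos_left (one_pos.trans ha) hα0.le
  obtain ⟨θ, hθ, s, hs, hexp⟩ := exists_forall_le_mul_of_mul_one_sub_rpow_le hα0 ha
  have hβ : 0 < 1 / α := one_div_pos.2 hα0
  obtain ⟨δ, hδ, hδle⟩ := exists_two_mul_add_mul_rpow_le (ε := 1 / 4)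
    (tailConst r ((1 / a) ^ (1 / α)) θ (1 / α)) hβ hs (by norm_num)
  refine ⟨δ ^ 2 / 2 * r, mul_pos (half_pos (pow_pos hδ.1 2)) hr, fun f hf hl hr' hc => ?_⟩
  have hO : HasTightOrbits f.zeroExtension δ :=
    (hf.expandsTails hα0 ha0 hexp hl hr').hasTightOrbits (hf.fullKoebeMap hα) hθ (by positivity)
      hβ hr hc hδ hδle
  obtain ⟨μ, hμ, hle⟩ := hf.exists_forall_isACIP_iff_eq hα hδ.1 hO
  simp only [hμ, forall_eq, existsUnique_eq, true_and]
  have := ((hμ μ).2 rfl).prob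
  have hδ2 : 0 ≤ δ ^ 2 / 2 := by positivity
  constructor
  · grw [← mul_sub_le_measureReal_Icc hδ2 hle le_rfl f.c_mem.2.le, sub_zero, ← hc.1]
  · grw [← mul_sub_le_measureReal_Icc hδ2 hle f.c_mem.1.le le_rfl, ← le_sub_comm.1 hc.2]

theorem mainTheorem6 (α : ℝ) (hα : 1 < α) :
    ∃ ε : ℝ, 0 < ε ∧
      ∀ K : ℝ, 0 < K →
        ∃ w : ℝ, 0 < w ∧
          ∀ f : LorenzMap α, f.IsFull → f.CloseToStandard ε →
            f.c ∈ Icc (1 / K) (1 - 1 / K) →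
              (∃! μ : Measure ℝ, f.IsACIP μ) ∧
              ∀ μ : Measure ℝ, f.IsACIP μ →
                w ≤ μ.real (Icc 0 f.c) ∧ w ≤ μ.real (Icc f.c 1) := by
  have hα0 : 0 < α := one_pos.trans hα
  obtain ⟨a, haα, ha⟩ := exists_between ((div_lt_one hα0).2 hα)
  refine ⟨1 - a, sub_pos.2 ha, fun K hK => ?_⟩
  obtain ⟨w, hw, hmain⟩ := mainTheorem6_general α hα.le ((div_lt_iff₀ hα0).1 haα) (one_div_pos.2 hK)
  exact ⟨w, hw, fun f hf hclose => hmain f hf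
    (fun x hx => by linarith [(abs_le.1 (hclose.1 x hx).2.1).1])
    (fun x hx => by linarith [(abs_le.1 (hclose.2 x hx).2.1).1])⟩
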